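/- **Setting.** For a measurable space $E$ let $\mathcal P(E)$ be the set of probability measures on $E$ and $\mathcal B(E)$ the set of bounded measurable functions $f:E\to\mathbb R$, with $\|f\|=\sup_x|f(x)|$ and $\operatorname{osc}(f)=\sup_{x,y}|f(x)-f(y)|$. Put $\mu(f)=\int f\,d\mu$, $\|\mu-\nu\|=\sup_{\|f\|\le1}|\mu(f)-\nu(f)|$ for $\mu,\nu\in\mathcal P(E)$, $\|K-L\|=\sup_x\|K(x,\cdot)-L(x,\cdot)\|$ for Markov kernels, and $\beta(K)=\sup\{\operatorname{osc}(K(f)):\operatorname{osc}(f)\le1\}$ (Dobrushin coefficient). Let $(S^{(l)})_{l\ge0}$ be measurable spaces, $\pi^{(l)}\in\mathcal P(S^{(l)})$, and $\Phi_l:\mathcal P(S^{(l-1)})\to\mathcal P(S^{(l)})$ mappings with $\pi^{(l)}=\Phi_l(\pi^{(l-1)})$, $l\ge1$. Let $M^{(0)}$ be a Markov transition on $S^{(0)}$ with invariant measure $\pi^{(0)}$ and, for $l\ge1$ and $\mu\in\mathcal P(S^{(l-1)})$, let $M^{(l)}_\mu$ be a Markov transition on $S^{(l)}$ with invariant measure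 $\Phi_l(\mu)$; set $M^{(0)}_\mu=M^{(0)}$. For all $l\ge 1$, $n\ge0$ and measurable $A$, the map $((x_0,\dots,x_n),x)\mapsto M^{(l)}_{\frac1{n+1}\sum_{p\le n}\delta_{x_p}}(x,A)$ is assumed measurable. Let $\nu_k\in\mathcal P(S^{(k)})$, $k\ge0$. **Interacting MCMC algorithm.** On a probability space let $X^{(k)}=(X^{(k)}_n)_{n\ge0}$, $k\ge0$, be processes in $S^{(k)}$ such that $X^{(0)}$ is a Markov chain with initial law $\nu_0$ and transition $M^{(0)}$ and, for every $k\ge1$, given the whole path $X^{(k-1)}$, the process $X^{(k)}$ is a Markov chain with initial law $\nu_k$ and $$\mathbb P\bigl(X^{(k)}_{n+1}\in dx\mid X^{(k-1)},X^{(k)}_0,\dots,X^{(k)}_n\bigr)=M^{(k)}_{\eta^{(k-1)}_n}(X^{(k)}_n,dx),\qquad \eta^{(k)}_n:=\frac1{n+1}\sum_{p=0}^n\delta_{X^{(k)}_p}.$$ **Conditions.** 1. (Weak Lipschitz condition.) For every $l\ge1$ there are $\Lambda_l\in[0,\infty)$, a $\sigma$-algebra on $\mathcal B(S^{(l-1)})$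 and, for each $f\in\mathcal B(S^{(l)})$, an s-finite (for example finite) positive measure $\Gamma_l(f,dg)$ on $\mathcal B(S^{(l-1)})$ such that for all $f$ and all $\mu,\nu\in\mathcal P(S^{(l-1)})$ $$|[\Phi_l(\mu)-\Phi_l(\nu)](f)|\le\int|[\mu-\nu](g)|\,\Gamma_l(f,dg),\qquad \int\|g\|\,\Gamma_l(f,dg)\le\Lambda_l\|f\|.$$ Here $(x,g)\mapsto g(x)$ is assumed measurable up to null sets for $\mu\otimes\Gamma_l(f,\cdot)$, for every $f$ and $\mu$, and $g\mapsto\|g\|$ measurable up to null sets for $\Gamma_l(f,\cdot)$. 2. (Regularity and mixing of the transitions.) There are constants $c_l\ge0$ and integers $n_l\ge0$, $l\ge0$, such that $\|M^{(l)}_\mu-M^{(l)}_\nu\|\le c_l\|\mu-\nu\|$ for all $l\ge1$ and $\mu,\nu\in\mathcal P(S^{(l-1)})$, and $$b_l(n_l):=\sup_\mu\beta\bigl((M^{(l)}_\mu)^{n_l}\bigr)<1\quad(l\ge1),\qquad b_0(n_0):=\beta\bigl((M^{(0)})^{n_0}\bigr)<1 .$$ **Theorem.** For every real $r\ge1$ there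 is a finite constant $e(r)$, depending only on $r$ and on none of the objects above, such that under conditions 1 and 2, for all $k\ge0$, all $f\in\mathcal B(S^{(k)})$ with $\|f\|\le1$ and all $n\ge0$, $$\sqrt{n+1}\;\mathbb E\Bigl(\bigl|[\eta^{(k)}_n-\pi^{(k)}](f)\bigr|^r\Bigr)^{1/r}\le e(r)\sum_{l=0}^k(1+c_l)\Bigl(\frac{n_l}{1-b_l(n_l)}\Bigr)^2\prod_{l<i\le k}2\Lambda_i .$$ -/

import Mathlib

open MeasureTheory ProbabilityTheory
open scoped NNReal ENNReal

universe u v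

namespace IMCMC

noncomputable section

/-- The set `𝓑(E)` of bounded measurable real functions on `E`. -/
def BM (E : Type u) [MeasurableSpace E] : Type u :=
  {f : E → ℝ // Measurable f ∧ ∃ C : ℝ, ∀ x, |f x| ≤ C}

instance {E : Type u} [MeasurableSpace E] : CoeFun (BM E) (fun _ => E → ℝ) :=
  ⟨fun f => f.1⟩

/-- The uniform norm `‖f‖ = sup_x |f x|`. -/
def supNorm {E : Type u} (f : E → ℝ) : ℝ := ⨆ x, |f x|

/-- The oscillation `osc f = sup_{x, y} |f x - f y|`. -/
def osc {E : Type u} (f : E → ℝ) : ℝ := ⨆ p : E × E, |f p.1 - f p.2|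

/-- The total variation distance `‖μ - ν‖ = sup_{‖f‖ ≤ 1} |μ f - ν f|` (with values in `[0, 2]` for
probability measures). -/
def tvDist {E : Type u} [MeasurableSpace E] (μ ν : Measure E) : ℝ :=
  ⨆ f : {f : BM E // supNorm f ≤ 1}, |∫ x, f.1 x ∂μ - ∫ x, f.1 x ∂ν|

/-- The norm `‖K - L‖ = sup_x ‖K(x, ·) - L(x, ·)‖` of the difference of two Markov kernels. -/
def kernelDist {E : Type u} [MeasurableSpace E] (K L : Kernel E E) : ℝ :=
  ⨆ x, tvDist (K x) (L x)

/-- The Dobrushin coefficient `β(K) = sup {osc (K f) ; osc f ≤ 1}`. -/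
def dobrushin {E : Type u} [MeasurableSpace E] (K : Kernel E E) : ℝ :=
  ⨆ f : {f : BM E // osc f ≤ 1}, osc (fun x => ∫ y, f.1 y ∂(K x))

/-- The empirical measure `(n + 1)⁻¹ ∑_{p ≤ n} δ_{x p}` of `n + 1` points. -/
def empirical {E : Type u} [MeasurableSpace E] {n : ℕ} (x : Fin (n + 1) → E) :
    ProbabilityMeasure E :=
  ⟨((n + 1 : ℕ) : ℝ≥0∞)⁻¹ • ∑ p : Fin (n + 1), Measure.dirac (x p), ⟨by
    simp only [Measure.smul_apply, Measure.finsetSum_apply, smul_eq_mul]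
    simp only [measure_univ, Finset.sum_const, Finset.card_univ, Fintype.card_fin, nsmul_eq_mul,
      mul_one]
    exact ENNReal.inv_mul_cancel (by simp) (ENNReal.natCast_ne_top _)⟩⟩

/-- The weak Lipschitz condition on a mapping `Φ : 𝓟(E) → 𝓟(F)`, with constant `Λ`:
`|[Φ μ - Φ ν] f| ≤ ∫ |[μ - ν] g| Γ(f, dg)` for some positive kernel `Γ` from `𝓑(F)` into `𝓑(E)`
with `∫ ‖g‖ Γ(f, dg) ≤ Λ ‖f‖`. The σ-algebra on `𝓑(E)` is free. The integrand `(x, g) ↦ g x` is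
required to be jointly measurable only up to null sets of `μ ⊗ Γ(f, ·)`, since no σ-algebra on
`𝓑(E)` makes evaluation jointly measurable in general. Measurability of `Γ` in `f` is not
required. -/
def WeakLipschitz {E F : Type u} [MeasurableSpace E] [MeasurableSpace F]
    (Φ : ProbabilityMeasure E → ProbabilityMeasure F) (Λ : ℝ≥0) : Prop :=
  ∃ (_ : MeasurableSpace (BM E)) (Γ : BM F → Measure (BM E)),
    ∀ f : BM F,
      SFinite (Γ f) ∧
      (∀ μ : ProbabilityMeasure E,
        AEMeasurable (fun p : E × BM E => p.2 p.1) ((μ : Measure E).prod (Γ f))) ∧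
      AEMeasurable (fun g : BM E => supNorm g) (Γ f) ∧
      (∀ μ ν : ProbabilityMeasure E,
        ENNReal.ofReal |∫ y, f y ∂(Φ μ : Measure F) - ∫ y, f y ∂(Φ ν : Measure F)| ≤
          ∫⁻ g : BM E, ENNReal.ofReal
            |∫ x, g x ∂(μ : Measure E) - ∫ x, g x ∂(ν : Measure E)| ∂(Γ f)) ∧
      ∫⁻ g : BM E, ENNReal.ofReal (supNorm g) ∂(Γ f) ≤ Λ * ENNReal.ofReal (supNorm f)

/-- The data of the interacting MCMC algorithm. Here `Φ l` and `M l μ` are the mapping and the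
Markov transition that lead from level `l` to level `l + 1`; `M0` is the transition of level `0`,
and `ν k` the initial distribution of the chain of level `k`. -/
structure Model (S : ℕ → Type u) [∀ l, MeasurableSpace (S l)] where
  π : ∀ l, ProbabilityMeasure (S l)
  Φ : ∀ l, ProbabilityMeasure (S l) → ProbabilityMeasure (S (l + 1))
  π_succ : ∀ l, π (l + 1) = Φ l (π l)
  M0 : Kernel (S 0) (S 0)
  M0_markov : IsMarkovKernel M0
  M0_invariant : M0.Invariant (π 0 : Measure (S 0))
  M : ∀ l, ProbabilityMeasure (S l) → Kernel (S (l + 1)) (S (l + 1))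
  M_markov : ∀ l μ, IsMarkovKernel (M l μ)
  M_invariant : ∀ l μ, (M l μ).Invariant (Φ l μ : Measure (S (l + 1)))
  /-- The random transitions that drive the chains depend measurably on the past. -/
  M_measurable : ∀ l n, Measurable (fun p : (Fin (n + 1) → S l) × S (l + 1) =>
    M l (empirical p.1) p.2)
  ν : ∀ k, ProbabilityMeasure (S k)

variable {S : ℕ → Type u} [∀ l, MeasurableSpace (S l)]

/-- The mixing coefficient `b_l(n) = sup_μ β((M_μ^{(l)})^n)`, where `M_μ^{(0)} = M^{(0)}`. -/
def Model.b (m : Model S) : ℕ → ℕ → ℝ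
  | 0, n => dobrushin (m.M0 ^ n)
  | l + 1, n => ⨆ μ : ProbabilityMeasure (S l), dobrushin (m.M l μ ^ n)

/-- The σ-algebra generated by `X_0, …, X_n`. -/
abbrev pastSigma {Ω : Type v} {E : Type u} [MeasurableSpace E] (X : ℕ → Ω → E) (n : ℕ) :
    MeasurableSpace Ω :=
  MeasurableSpace.comap (fun ω (i : Fin (n + 1)) => X i ω) inferInstance

/-- The σ-algebra generated by the whole path of `X`. -/
abbrev pathSigma {Ω : Type v} {E : Type u} [MeasurableSpace E] (X : ℕ → Ω → E) :
    MeasurableSpace Ω :=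
  MeasurableSpace.comap (fun ω (i : ℕ) => X i ω) inferInstance

/-- The occupation measure `η_n = (n + 1)⁻¹ ∑_{p ≤ n} δ_{X_p}`. -/
def occ {Ω : Type v} {E : Type u} [MeasurableSpace E] (X : ℕ → Ω → E) (n : ℕ) (ω : Ω) :
    ProbabilityMeasure E :=
  empirical (fun i : Fin (n + 1) => X i ω)

/-- `X k n` is the state at time `n` of the chain of level `k` of an interacting MCMC algorithm:
`X 0` is a Markov chain with initial law `ν 0` and transition `M0`; given the path of `X k`, the
process `X (k + 1)` is a Markov chain with initial law `ν (k + 1)` and with transition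
`M_{η_n}` at time `n`, where `η_n` is the occupation measure of `X k` at time `n`. -/
structure IsChain (m : Model S) {Ω : Type v} [MeasurableSpace Ω] (P : Measure Ω)
    (X : ∀ k, ℕ → Ω → S k) : Prop where
  measurable : ∀ k n, Measurable (X k n)
  init_zero : P.map (X 0 0) = (m.ν 0 : Measure (S 0))
  step_zero : ∀ n (A : Set (S 0)), MeasurableSet A →
    P⟦X 0 (n + 1) ⁻¹' A | pastSigma (X 0) n⟧ =ᵐ[P] fun ω => (m.M0 (X 0 n ω)).real A
  init_succ : ∀ k (A : Set (S (k + 1))), MeasurableSet A →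
    P⟦X (k + 1) 0 ⁻¹' A | pathSigma (X k)⟧ =ᵐ[P]
      fun _ => (m.ν (k + 1) : Measure (S (k + 1))).real A
  step_succ : ∀ k n (A : Set (S (k + 1))), MeasurableSet A →
    P⟦X (k + 1) (n + 1) ⁻¹' A | pathSigma (X k) ⊔ pastSigma (X (k + 1)) n⟧ =ᵐ[P]
      fun ω => (m.M k (occ (X k) n ω) (X (k + 1) n ω)).real A

end

end IMCMC

namespace IMCMC

open Filter Topology

/-! ### Bounded measurable functions -/

/-- Bounded measurable real functions. -/
def IsBM {E : Type*} [MeasurableSpace E] (f : E → ℝ) : Prop :=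
  Measurable f ∧ ∃ C : ℝ, ∀ x, |f x| ≤ C

section BoundedMeasurable

variable {E : Type*} [MeasurableSpace E]

lemma IsBM.measurable {f : E → ℝ} (hf : IsBM f) : Measurable f := hf.1

lemma IsBM.integrable {f : E → ℝ} (hf : IsBM f) (μ : Measure E) [IsFiniteMeasure μ] :
    Integrable f μ := by
  obtain ⟨hm, C, hC⟩ := hf
  exact Integrable.of_bound hm.aestronglyMeasurable C (ae_of_all _ hC)

lemma IsBM.const (c : ℝ) : IsBM (fun _ : E => c) := ⟨measurable_const, |c|, fun _ => le_rfl⟩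

lemma IsBM.sub {f g : E → ℝ} (hf : IsBM f) (hg : IsBM g) : IsBM (fun x => f x - g x) := by
  obtain ⟨hf, C, hC⟩ := hf
  obtain ⟨hg, D, hD⟩ := hg
  exact ⟨hf.sub hg, C + D, fun x => (abs_sub _ _).trans (add_le_add (hC x) (hD x))⟩

lemma IsBM.const_mul {f : E → ℝ} (hf : IsBM f) (c : ℝ) : IsBM (fun x => c * f x) := by
  obtain ⟨hf, C, hC⟩ := hf
  refine ⟨hf.const_mul c, |c| * C, fun x => ?_⟩
  rw [abs_mul]
  exact mul_le_mul_of_nonneg_left (hC x) (abs_nonneg c)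

lemma IsBM.sum {ι : Type*} {s : Finset ι} {f : ι → E → ℝ} (hf : ∀ i ∈ s, IsBM (f i)) :
    IsBM (fun x => ∑ i ∈ s, f i x) := by
  classical
  induction s using Finset.induction_on with
  | empty => simpa using IsBM.const (E := E) 0
  | insert i s hi ih =>
    obtain ⟨h1, C, hC⟩ := hf i (Finset.mem_insert_self _ _)
    obtain ⟨h2, D, hD⟩ := ih (fun j hj => hf j (Finset.mem_insert_of_mem hj))
    simp only [Finset.sum_insert hi]
    exact ⟨h1.add h2, C + D, fun x => (abs_add_le _ _).trans (add_le_add (hC x) (hD x))⟩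

lemma abs_integral_sub_le {f : E → ℝ} (hf : IsBM f) (μ : Measure E) [IsProbabilityMeasure μ]
    {c a : ℝ} (h : ∀ y, |c - f y| ≤ a) : |c - ∫ y, f y ∂μ| ≤ a := by
  have : c - ∫ y, f y ∂μ = ∫ y, (c - f y) ∂μ := by
    rw [integral_sub (integrable_const _) (hf.integrable μ)]
    simp
  rw [this]
  simpa using norm_integral_le_of_norm_le_const (μ := μ) (f := fun y => c - f y) (C := a)
    (ae_of_all _ h)

lemma abs_le_supNorm {f : E → ℝ} (hf : IsBM f) (x : E) : |f x| ≤ supNorm f := by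
  obtain ⟨-, C, hC⟩ := hf
  exact le_ciSup (f := fun x => |f x|) ⟨C, by rintro _ ⟨y, rfl⟩; exact hC y⟩ x

omit [MeasurableSpace E] in
lemma supNorm_nonneg (f : E → ℝ) : 0 ≤ supNorm f := Real.iSup_nonneg fun _ => abs_nonneg _

omit [MeasurableSpace E] in
lemma osc_nonneg (f : E → ℝ) : 0 ≤ osc f := Real.iSup_nonneg fun _ => abs_nonneg _

lemma abs_sub_le_osc {f : E → ℝ} (hf : IsBM f) (x y : E) : |f x - f y| ≤ osc f := by
  obtain ⟨-, C, hC⟩ := hf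
  refine le_ciSup (f := fun p : E × E => |f p.1 - f p.2|) ⟨C + C, ?_⟩ (x, y)
  rintro _ ⟨p, rfl⟩
  exact (abs_sub _ _).trans (add_le_add (hC _) (hC _))

omit [MeasurableSpace E] in
lemma osc_le {f : E → ℝ} {a : ℝ} (ha : 0 ≤ a) (h : ∀ x y, |f x - f y| ≤ a) : osc f ≤ a :=
  Real.iSup_le (fun p => h p.1 p.2) ha

lemma abs_integral_sub_integral_le_tvDist {f : E → ℝ} (hf : IsBM f) {C : ℝ}
    (hC : ∀ x, |f x| ≤ C) (μ ν : Measure E) [IsProbabilityMeasure μ] [IsProbabilityMeasure ν] :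
    |∫ x, f x ∂μ - ∫ x, f x ∂ν| ≤ C * tvDist μ ν := by
  have bound : ∀ g : {f : BM E // supNorm f ≤ 1},
      |∫ x, g.1 x ∂μ - ∫ x, g.1 x ∂ν| ≤ 2 := by
    intro g
    have h1 : ∀ ρ : Measure E, IsProbabilityMeasure ρ → |∫ x, g.1 x ∂ρ| ≤ 1 := by
      intro ρ hρ
      simpa using norm_integral_le_of_norm_le_const (μ := ρ) (f := fun y => g.1 y) (C := 1)
        (ae_of_all _ fun x => (abs_le_supNorm g.1.2 x).trans g.2)
    have := abs_sub (∫ x, g.1 x ∂μ) (∫ x, g.1 x ∂ν)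
    linarith [h1 μ inferInstance, h1 ν inferInstance]
  have hbdd : BddAbove (Set.range fun g : {f : BM E // supNorm f ≤ 1} =>
      |∫ x, g.1 x ∂μ - ∫ x, g.1 x ∂ν|) := ⟨2, by rintro _ ⟨g, rfl⟩; exact bound g⟩
  have hE : Nonempty E := μ.nonempty_of_neZero
  have hC0 : 0 ≤ C := (abs_nonneg _).trans (hC hE.some)
  rcases hC0.eq_or_lt with rfl | hC0
  · have : f = fun _ => 0 := by
      funext x
      exact abs_nonpos_iff.1 (hC x)
    simp [this]
  · have hn : supNorm (fun x => C⁻¹ * f x) ≤ 1 := by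
      refine Real.iSup_le (fun x => ?_) zero_le_one
      rw [abs_mul, abs_of_pos (inv_pos.2 hC0), inv_mul_le_iff₀ hC0, mul_one]
      exact hC x
    have := le_ciSup hbdd ⟨⟨fun x => C⁻¹ * f x, hf.const_mul _⟩, hn⟩
    simp only [integral_const_mul, ← mul_sub, abs_mul, abs_of_pos (inv_pos.2 hC0)] at this
    rwa [inv_mul_le_iff₀ hC0] at this

lemma tvDist_le {μ ν : Measure E} {a : ℝ} (ha : 0 ≤ a)
    (h : ∀ f : E → ℝ, IsBM f → (∀ x, |f x| ≤ 1) → |∫ x, f x ∂μ - ∫ x, f x ∂ν| ≤ a) :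
    tvDist μ ν ≤ a :=
  Real.iSup_le (fun f => h f.1 f.1.2 fun x => (abs_le_supNorm f.1.2 x).trans f.2) ha

lemma tvDist_le_two (μ ν : Measure E) [IsProbabilityMeasure μ] [IsProbabilityMeasure ν] :
    tvDist μ ν ≤ 2 := by
  refine tvDist_le zero_le_two fun f hf h => ?_
  have h1 : ∀ ρ : Measure E, IsProbabilityMeasure ρ → |∫ x, f x ∂ρ| ≤ 1 := by
    intro ρ hρ
    simpa using norm_integral_le_of_norm_le_const (μ := ρ) (f := f) (C := 1) (ae_of_all _ h)
  have := abs_sub (∫ x, f x ∂μ) (∫ x, f x ∂ν)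
  linarith [h1 μ inferInstance, h1 ν inferInstance]

lemma tvDist_le_kernelDist (K L : Kernel E E) [IsMarkovKernel K] [IsMarkovKernel L] (x : E) :
    tvDist (K x) (L x) ≤ kernelDist K L :=
  le_ciSup (f := fun x => tvDist (K x) (L x))
    ⟨2, by rintro _ ⟨y, rfl⟩; exact tvDist_le_two _ _⟩ x

end BoundedMeasurable

/-! ### The action of a Markov kernel on bounded functions -/

section Action

variable {E : Type*} [MeasurableSpace E]

/-- The function `K f : x ↦ ∫ f(y) K(x, dy)`. -/
noncomputable def act (K : Kernel E E) (f : E → ℝ) (x : E) : ℝ := ∫ y, f y ∂(K x)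

variable {K : Kernel E E} [IsMarkovKernel K]

instance isMarkovKernel_pow (n : ℕ) : IsMarkovKernel (K ^ n) := by
  induction n with
  | zero => rw [pow_zero]; exact inferInstanceAs (IsMarkovKernel Kernel.id)
  | succ n ih => rw [pow_succ]; exact inferInstanceAs (IsMarkovKernel ((K ^ n) ∘ₖ K))

lemma IsBM.kernel_act {f : E → ℝ} (hf : IsBM f) (K : Kernel E E) [IsMarkovKernel K] :
    IsBM (act K f) := by
  obtain ⟨hm, C, hC⟩ := hf
  refine ⟨(StronglyMeasurable.integral_kernel hm.stronglyMeasurable).measurable, C, fun x => ?_⟩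
  simpa [act] using norm_integral_le_of_norm_le_const (μ := K x) (f := f) (C := C) (ae_of_all _ hC)

omit [IsMarkovKernel K] in
lemma act_pow_zero {f : E → ℝ} (hf : IsBM f) : act (K ^ 0) f = f := by
  funext x
  change ∫ y, f y ∂(Kernel.id x) = f x
  rw [Kernel.id_apply, integral_dirac' _ _ hf.measurable.stronglyMeasurable]

lemma act_pow_add {f : E → ℝ} (hf : IsBM f) (m n : ℕ) :
    act (K ^ (m + n)) f = act (K ^ n) (act (K ^ m) f) := by
  funext x
  unfold act
  rw [Kernel.pow_add]
  exact Kernel.integral_comp (hf.integrable _)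

lemma act_pow_succ {f : E → ℝ} (hf : IsBM f) (n : ℕ) :
    act (K ^ (n + 1)) f = act K (act (K ^ n) f) := by
  rw [act_pow_add hf, pow_one]

lemma act_sub {f g : E → ℝ} (hf : IsBM f) (hg : IsBM g) (x : E) :
    act K (fun x => f x - g x) x = act K f x - act K g x :=
  integral_sub (hf.integrable _) (hg.integrable _)

lemma act_const (c : ℝ) (x : E) : act K (fun _ => c) x = c := by simp [act]

lemma act_sum {ι : Type*} {s : Finset ι} {f : ι → E → ℝ} (hf : ∀ i ∈ s, IsBM (f i)) (x : E) :
    act K (fun x => ∑ i ∈ s, f i x) x = ∑ i ∈ s, act K (f i) x :=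
  integral_finsetSum _ fun i hi => (hf i hi).integrable _

lemma abs_act_sub_act_le_osc {f : E → ℝ} (hf : IsBM f) {a : ℝ} (h : ∀ x y, |f x - f y| ≤ a)
    (x y : E) : |act K f x - act K f y| ≤ a := by
  refine abs_integral_sub_le hf (K y) fun z => ?_
  rw [abs_sub_comm]
  exact abs_integral_sub_le hf (K x) fun w => h z w

lemma bddAbove_dobrushin (K : Kernel E E) [IsMarkovKernel K] :
    BddAbove (Set.range fun f : {f : BM E // osc f ≤ 1} => osc (fun x => ∫ y, f.1 y ∂(K x))) := by
  refine ⟨1, ?_⟩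
  rintro _ ⟨f, rfl⟩
  exact osc_le zero_le_one
    (abs_act_sub_act_le_osc f.1.2 fun x y => (abs_sub_le_osc f.1.2 x y).trans f.2)

lemma dobrushin_nonneg (K : Kernel E E) : 0 ≤ dobrushin K := Real.iSup_nonneg fun _ => osc_nonneg _

lemma dobrushin_le_one (K : Kernel E E) [IsMarkovKernel K] : dobrushin K ≤ 1 :=
  Real.iSup_le (fun f => osc_le zero_le_one
    (abs_act_sub_act_le_osc f.1.2 fun x y => (abs_sub_le_osc f.1.2 x y).trans f.2)) zero_le_one

lemma abs_act_sub_act_le {f : E → ℝ} (hf : IsBM f) {a : ℝ} (h : ∀ x y, |f x - f y| ≤ a)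
    (x y : E) : |act K f x - act K f y| ≤ dobrushin K * a := by
  have ha : 0 ≤ a := (abs_nonneg _).trans (h x y)
  rcases ha.eq_or_lt with rfl | ha
  · simpa using abs_act_sub_act_le_osc (K := K) hf h x y
  · have hn : osc (fun x => a⁻¹ * f x) ≤ 1 := by
      refine osc_le zero_le_one fun x y => ?_
      rw [← mul_sub, abs_mul, abs_of_pos (inv_pos.2 ha), inv_mul_le_iff₀ ha, mul_one]
      exact h x y
    have h1 := le_ciSup (bddAbove_dobrushin K) ⟨⟨fun x => a⁻¹ * f x, hf.const_mul _⟩, hn⟩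
    have h2 := (abs_sub_le_osc ((hf.const_mul a⁻¹).kernel_act K) x y).trans h1
    unfold act at h2 ⊢
    simp only [integral_const_mul, ← mul_sub, abs_mul, abs_of_pos (inv_pos.2 ha)] at h2
    rwa [inv_mul_le_iff₀ ha, mul_comm] at h2

lemma abs_act_pow_sub_le {N : ℕ} {b : ℝ} (hb : dobrushin (K ^ N) ≤ b) {f : E → ℝ} (hf : IsBM f)
    {a : ℝ} (h : ∀ x y, |f x - f y| ≤ a) (s q : ℕ) (x y : E) :
    |act (K ^ (s + q * N)) f x - act (K ^ (s + q * N)) f y| ≤ b ^ q * a := by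
  induction q generalizing x y with
  | zero => simpa using abs_act_sub_act_le_osc (K := K ^ s) hf h x y
  | succ q ih =>
    have ha : 0 ≤ a := (abs_nonneg _).trans (h x y)
    have hb0 : 0 ≤ b := (dobrushin_nonneg _).trans hb
    rw [show s + (q + 1) * N = (s + q * N) + N by ring, act_pow_add hf]
    refine (abs_act_sub_act_le (hf.kernel_act _) ih x y).trans ?_
    rw [pow_succ, mul_comm _ b, mul_assoc]
    gcongr

end Action

/-! ### The Poisson equation -/

section Poisson

variable {E : Type*} [MeasurableSpace E] {K : Kernel E E} [IsMarkovKernel K]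

/-- A solution of the Poisson equation, normalised to vanish at `x₀`. -/
noncomputable def poisson (K : Kernel E E) (N : ℕ) (x₀ : E) (f : E → ℝ) (x : E) : ℝ :=
  ∑' q : ℕ, ∑ s ∈ Finset.range N, (act (K ^ (s + q * N)) f x - act (K ^ (s + q * N)) f x₀)

variable {N : ℕ} {b : ℝ} {f : E → ℝ} {a : ℝ}

lemma abs_sum_act_pow_sub_le (hb : dobrushin (K ^ N) ≤ b) (hf : IsBM f)
    (h : ∀ x y, |f x - f y| ≤ a) (q : ℕ) (x y : E) :
    |∑ s ∈ Finset.range N, (act (K ^ (s + q * N)) f x - act (K ^ (s + q * N)) f y)| ≤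
      b ^ q * (N * a) := by
  refine (Finset.abs_sum_le_sum_abs _ _).trans ?_
  refine (Finset.sum_le_sum fun s _ => abs_act_pow_sub_le hb hf h s q x y).trans ?_
  simp only [Finset.sum_const, Finset.card_range, nsmul_eq_mul]
  exact (by ring : (N : ℝ) * (b ^ q * a) = b ^ q * (N * a)).le

lemma hasSum_poisson (hb : dobrushin (K ^ N) ≤ b) (hb1 : b < 1) (hf : IsBM f)
    (x₀ x : E) :
    HasSum (fun q : ℕ => ∑ s ∈ Finset.range N,
      (act (K ^ (s + q * N)) f x - act (K ^ (s + q * N)) f x₀)) (poisson K N x₀ f x) := by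
  have hb0 : 0 ≤ b := (dobrushin_nonneg _).trans hb
  refine Summable.hasSum (Summable.of_norm_bounded
    ((summable_geometric_of_lt_one hb0 hb1).mul_right (N * osc f)) fun q => ?_)
  exact abs_sum_act_pow_sub_le hb hf (abs_sub_le_osc hf) q x x₀

lemma sum_range_blocks (u : ℕ → ℝ) (N m : ℕ) :
    ∑ q ∈ Finset.range m, ∑ s ∈ Finset.range N, u (s + q * N) = ∑ i ∈ Finset.range (m * N), u i := by
  induction m with
  | zero => simp
  | succ m ih =>
    rw [Finset.sum_range_succ, ih, Nat.succ_mul, Finset.sum_range_add]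
    simp [add_comm]

lemma tendsto_poisson (hb : dobrushin (K ^ N) ≤ b) (hb1 : b < 1) (hf : IsBM f) (x₀ x : E) :
    Tendsto (fun m : ℕ => ∑ i ∈ Finset.range (m * N), (act (K ^ i) f x - act (K ^ i) f x₀))
      atTop (𝓝 (poisson K N x₀ f x)) := by
  refine (hasSum_poisson hb hb1 hf x₀ x).tendsto_sum_nat.congr fun m => ?_
  exact sum_range_blocks (fun i => act (K ^ i) f x - act (K ^ i) f x₀) N m

lemma abs_sum_range_act_pow_sub_le (hb : dobrushin (K ^ N) ≤ b) (hb1 : b < 1) (hf : IsBM f)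
    (h : ∀ x y, |f x - f y| ≤ a) (m : ℕ) (x y : E) :
    |∑ i ∈ Finset.range (m * N), (act (K ^ i) f x - act (K ^ i) f y)| ≤ N / (1 - b) * a := by
  have hb0 : 0 ≤ b := (dobrushin_nonneg _).trans hb
  have ha : 0 ≤ a := (abs_nonneg _).trans (h x y)
  rw [← sum_range_blocks (fun i => act (K ^ i) f x - act (K ^ i) f y)]
  refine (Finset.abs_sum_le_sum_abs _ _).trans ?_
  refine (Finset.sum_le_sum fun q _ => abs_sum_act_pow_sub_le hb hf h q x y).trans ?_
  rw [← Finset.sum_mul]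
  have : ∑ q ∈ Finset.range m, b ^ q ≤ (1 - b)⁻¹ := by
    rw [← tsum_geometric_of_lt_one hb0 hb1]
    exact (summable_geometric_of_lt_one hb0 hb1).sum_le_tsum _ fun i _ => by positivity
  calc _ ≤ (1 - b)⁻¹ * (N * a) := by gcongr
    _ = _ := by rw [div_eq_inv_mul]; ring

omit [IsMarkovKernel K] in
lemma poisson_base (x₀ : E) : poisson K N x₀ f x₀ = 0 := by simp [poisson]

lemma abs_poisson_le (hb : dobrushin (K ^ N) ≤ b) (hb1 : b < 1) (hf : IsBM f)
    (h : ∀ x y, |f x - f y| ≤ a) (x₀ x : E) : |poisson K N x₀ f x| ≤ N / (1 - b) * a :=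
  le_of_tendsto (tendsto_poisson hb hb1 hf x₀ x).abs
    (Eventually.of_forall fun m => abs_sum_range_act_pow_sub_le hb hb1 hf h m x x₀)

attribute [irreducible] poisson

lemma IsBM.poisson_sol (hb : dobrushin (K ^ N) ≤ b) (hb1 : b < 1) (hf : IsBM f) (x₀ : E) :
    IsBM (poisson K N x₀ f) := by
  refine ⟨measurable_of_tendsto_metrizable (f := fun m x => ∑ i ∈ Finset.range (m * N),
      (act (K ^ i) f x - act (K ^ i) f x₀)) (fun m => ?_)
      (tendsto_pi_nhds.2 fun x => tendsto_poisson hb hb1 hf x₀ x),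
    _, abs_poisson_le hb hb1 hf (abs_sub_le_osc hf) x₀⟩
  exact (IsBM.sum fun i _ => (hf.kernel_act (K ^ i)).sub (IsBM.const _)).measurable

/-- Iterating the equation `h - K h = g + c`. -/
lemma sub_act_pow_eq {h g : E → ℝ} {c : ℝ} (hh : IsBM h) (hg : IsBM g)
    (heq : ∀ x, h x - act K h x = g x + c) (n : ℕ) (x : E) :
    h x = ∑ i ∈ Finset.range n, act (K ^ i) g x + n * c + act (K ^ n) h x := by
  induction n with
  | zero => rw [act_pow_zero hh]; simp
  | succ n ih =>
    have h1 : act (K ^ n) h x - act (K ^ (n + 1)) h x = act (K ^ n) g x + c := by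
      rw [add_comm n 1, act_pow_add hh, pow_one, ← act_sub hh (hh.kernel_act K)]
      have : (fun x => h x - act K h x) = fun x => g x - (fun _ => -c) x := by
        funext x; rw [heq]; ring
      rw [this, act_sub hg (IsBM.const _), act_const]
      ring
    rw [Finset.sum_range_succ, ih]
    push_cast
    linarith

lemma abs_sub_le_of_poisson (hb : dobrushin (K ^ N) ≤ b) (hb1 : b < 1) {h g : E → ℝ} {c : ℝ}
    (hh : IsBM h) (hg : IsBM g) (heq : ∀ x, h x - act K h x = g x + c)
    (ha : ∀ x y, |g x - g y| ≤ a) (x y : E) : |h x - h y| ≤ N / (1 - b) * a := by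
  have hb0 : 0 ≤ b := (dobrushin_nonneg _).trans hb
  have key : ∀ m : ℕ, |h x - h y| ≤ N / (1 - b) * a + b ^ m * osc h := by
    intro m
    have h1 := sub_act_pow_eq hh hg heq (m * N) x
    have h2 := sub_act_pow_eq hh hg heq (m * N) y
    have h3 : h x - h y = ∑ i ∈ Finset.range (m * N), (act (K ^ i) g x - act (K ^ i) g y) +
        (act (K ^ (m * N)) h x - act (K ^ (m * N)) h y) := by
      rw [Finset.sum_sub_distrib]; linarith
    rw [h3]
    refine (abs_add_le _ _).trans (add_le_add (abs_sum_range_act_pow_sub_le hb hb1 hg ha m x y) ?_)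
    simpa using abs_act_pow_sub_le hb hh (abs_sub_le_osc hh) 0 m x y
  have hlim : Tendsto (fun m : ℕ => N / (1 - b) * a + b ^ m * osc h) atTop
      (𝓝 (N / (1 - b) * a + 0 * osc h)) :=
    ((tendsto_pow_atTop_nhds_zero_of_lt_one hb0 hb1).mul_const _).const_add _
  rw [zero_mul, add_zero] at hlim
  exact ge_of_tendsto' hlim key

/-- The Poisson equation. -/
lemma poisson_sub_act (hb : dobrushin (K ^ N) ≤ b) (hb1 : b < 1) (hf : IsBM f) (x₀ : E)
    {π : Measure E} [IsProbabilityMeasure π] (hπ : K.Invariant π) (x : E) :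
    poisson K N x₀ f x - act K (poisson K N x₀ f) x = f x - ∫ y, f y ∂π := by
  have hb0 : 0 ≤ b := (dobrushin_nonneg _).trans hb
  have hbm : ∀ i, IsBM (fun x => act (K ^ i) f x - act (K ^ i) f x₀) := fun i =>
    (hf.kernel_act (K ^ i)).sub (IsBM.const _)
  have hact : Tendsto (fun m : ℕ => act K (fun x => ∑ i ∈ Finset.range (m * N),
      (act (K ^ i) f x - act (K ^ i) f x₀)) x) atTop (𝓝 (act K (poisson K N x₀ f) x)) := by
    refine tendsto_integral_of_dominated_convergence (fun _ => N / (1 - b) * osc f)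
      (fun m => ?_) (integrable_const _) (fun m => ae_of_all _ fun y => ?_)
      (ae_of_all _ fun y => tendsto_poisson hb hb1 hf x₀ y)
    · exact (IsBM.sum fun i _ => hbm i).measurable.aestronglyMeasurable
    · exact abs_sum_range_act_pow_sub_le hb hb1 hf (abs_sub_le_osc hf) m y x₀
  have hdiff := (tendsto_poisson hb hb1 hf x₀ x).sub hact
  have hpart : ∀ m : ℕ, ∑ i ∈ Finset.range (m * N), (act (K ^ i) f x - act (K ^ i) f x₀) -
      act K (fun x => ∑ i ∈ Finset.range (m * N),
        (act (K ^ i) f x - act (K ^ i) f x₀)) x = f x - act (K ^ (m * N)) f x := by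
    intro m
    rw [act_sum fun i _ => hbm i, ← Finset.sum_sub_distrib]
    have : ∀ i, act (K ^ i) f x - act (K ^ i) f x₀ -
        act K (fun x => act (K ^ i) f x - act (K ^ i) f x₀) x =
        act (K ^ i) f x - act (K ^ (i + 1)) f x := by
      intro i
      rw [act_sub (hf.kernel_act _) (IsBM.const _), act_const, act_pow_succ hf]
      ring
    simp only [this]
    rw [Finset.sum_range_sub', act_pow_zero hf]
  simp only [hpart] at hdiff
  have hinv : ∀ n, ∫ y, act (K ^ n) f y ∂π = ∫ y, f y ∂π := by
    intro n
    induction n with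
    | zero => rw [act_pow_zero hf]
    | succ n ih =>
      have hcomp : (K ∘ₖ Kernel.const Unit π) () = π := by
        rw [Kernel.comp_apply, Kernel.const_apply]; exact hπ
      have := Kernel.integral_comp (η := K) (κ := Kernel.const Unit π) (a := ())
        ((hf.kernel_act (K ^ n)).integrable _)
      rw [hcomp, Kernel.const_apply] at this
      rw [← ih, act_pow_succ hf]
      exact this.symm
  have hlim : Tendsto (fun m : ℕ => act (K ^ (m * N)) f x) atTop (𝓝 (∫ y, f y ∂π)) := by
    rw [tendsto_iff_norm_sub_tendsto_zero]
    refine squeeze_zero (fun _ => norm_nonneg _) (g := fun m => b ^ m * osc f) (fun m => ?_) ?_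
    · rw [← hinv (m * N)]
      refine abs_integral_sub_le (hf.kernel_act _) π fun y => ?_
      simpa using abs_act_pow_sub_le hb hf (abs_sub_le_osc hf) 0 m x y
    · simpa using (tendsto_pow_atTop_nhds_zero_of_lt_one hb0 hb1).mul_const (osc f)
  exact tendsto_nhds_unique hdiff (hlim.const_sub _)

/-- Stability of the solution of the Poisson equation under a perturbation of the kernel. -/
lemma abs_poisson_sub_poisson_le {L : Kernel E E} [IsMarkovKernel L]
    (hK : dobrushin (K ^ N) ≤ b) (hL : dobrushin (L ^ N) ≤ b) (hb1 : b < 1) (hf : IsBM f)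
    (h : ∀ x y, |f x - f y| ≤ a) (x₀ : E) {π ρ : Measure E} [IsProbabilityMeasure π]
    [IsProbabilityMeasure ρ] (hπ : K.Invariant π) (hρ : L.Invariant ρ) {δ : ℝ}
    (hδ : ∀ x, tvDist (K x) (L x) ≤ δ) (x : E) :
    |poisson K N x₀ f x - poisson L N x₀ f x| ≤ 2 * ((N : ℝ) / (1 - b)) ^ 2 * a * δ := by
  have hPK := hf.poisson_sol hK hb1 x₀
  have hPL := hf.poisson_sol hL hb1 x₀
  have hLbd := abs_poisson_le hL hb1 hf h x₀
  have hA : 0 ≤ (N : ℝ) / (1 - b) * a := (abs_nonneg _).trans (hLbd x)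
  set g : E → ℝ := fun x => act K (poisson L N x₀ f) x - act L (poisson L N x₀ f) x with hg
  have hgbd : ∀ x, |g x| ≤ N / (1 - b) * a * δ := fun x =>
    (abs_integral_sub_integral_le_tvDist hPL hLbd (K x) (L x)).trans
      (mul_le_mul_of_nonneg_left (hδ x) hA)
  have hgosc : ∀ x y, |g x - g y| ≤ 2 * (N / (1 - b) * a * δ) := fun x y => by
    have := abs_sub (g x) (g y)
    linarith [hgbd x, hgbd y]
  have hkey := abs_sub_le_of_poisson (K := K) (c := ∫ y, f y ∂ρ - ∫ y, f y ∂π) hK hb1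
    (hPK.sub hPL) ((hPL.kernel_act K).sub (hPL.kernel_act L)) (fun y => ?_) hgosc x x₀
  · simp only [poisson_base, sub_zero] at hkey
    calc _ ≤ _ := hkey
      _ = _ := by ring
  · rw [act_sub hPK hPL]
    have h1 := poisson_sub_act hK hb1 hf x₀ hπ y
    have h2 := poisson_sub_act hL hb1 hf x₀ hρ y
    linarith

end Poisson

/-! ### Moments of sums of bounded martingale increments -/

section Moments

variable {Ω : Type*} [MeasurableSpace Ω] {P : Measure Ω} [IsProbabilityMeasure P]

/-- The Azuma–Hoeffding bound on exponential moments. -/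
lemma integral_exp_mul_sum_le {d : ℕ → Ω → ℝ} {σ : ℝ} (hσ : 0 < σ) (hd : ∀ i, Measurable (d i))
    (hdσ : ∀ i ω, |d i ω| ≤ σ) (t : ℝ)
    (hmart : ∀ n, ∫ ω, Real.exp (t * ∑ i ∈ Finset.range n, d i ω) * d n ω ∂P = 0) (n : ℕ) :
    ∫ ω, Real.exp (t * ∑ i ∈ Finset.range n, d i ω) ∂P ≤ Real.exp (n * ((t * σ) ^ 2 / 2)) := by
  have hS : ∀ n, Measurable fun ω => ∑ i ∈ Finset.range n, d i ω := fun n =>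
    Finset.measurable_fun_sum _ fun i _ => hd i
  have hE : ∀ n, IsBM fun ω => Real.exp (t * ∑ i ∈ Finset.range n, d i ω) := by
    refine fun n => ⟨((hS n).const_mul t).exp, Real.exp (|t| * (n * σ)), fun ω => ?_⟩
    rw [Real.abs_exp, Real.exp_le_exp]
    refine (le_abs_self _).trans ?_
    rw [abs_mul]
    refine mul_le_mul_of_nonneg_left ?_ (abs_nonneg t)
    refine (Finset.abs_sum_le_sum_abs _ _).trans ((Finset.sum_le_sum fun i _ => hdσ i ω).trans ?_)
    simp
  induction n with
  | zero => simp
  | succ n ih =>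
    have hpt : ∀ ω, Real.exp (t * ∑ i ∈ Finset.range (n + 1), d i ω) ≤
        Real.cosh (t * σ) * Real.exp (t * ∑ i ∈ Finset.range n, d i ω) +
        (σ⁻¹ * Real.sinh (t * σ)) *
          (Real.exp (t * ∑ i ∈ Finset.range n, d i ω) * d n ω) := by
      intro ω
      have h1 : |d n ω / σ| ≤ 1 := by
        rw [abs_div, abs_of_pos hσ, div_le_one hσ]; exact hdσ n ω
      have h2 := Real.exp_mul_le_cosh_add_mul_sinh h1 (t * σ)
      rw [show d n ω / σ * (t * σ) = t * d n ω by field_simp] at h2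
      rw [Finset.sum_range_succ, mul_add, Real.exp_add]
      refine (mul_le_mul_of_nonneg_left h2 (Real.exp_pos _).le).trans (le_of_eq ?_)
      rw [div_eq_inv_mul]; ring
    have hi1 := (hE n).integrable P
    have hi2 : Integrable (fun ω => Real.exp (t * ∑ i ∈ Finset.range n, d i ω) * d n ω) P :=
      hi1.mul_bdd (hd n).aestronglyMeasurable (ae_of_all _ (hdσ n))
    refine (integral_mono ((hE (n + 1)).integrable P)
      ((hi1.const_mul _).add (hi2.const_mul _)) hpt).trans ?_
    simp only [Pi.add_apply]
    rw [integral_add (hi1.const_mul _) (hi2.const_mul _), integral_const_mul,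
      integral_const_mul, hmart, mul_zero, add_zero]
    calc _ ≤ Real.exp ((t * σ) ^ 2 / 2) * Real.exp (n * ((t * σ) ^ 2 / 2)) :=
          mul_le_mul (Real.cosh_le_exp_half_sq _) ih (integral_nonneg fun _ => (Real.exp_pos _).le)
            (Real.exp_pos _).le
      _ = _ := by rw [← Real.exp_add]; push_cast; ring_nf

/-- The constant in the moment inequality for martingales with bounded increments. -/
noncomputable def momentConst (r : ℝ) : ℝ := (4 * (1 + (⌈r⌉₊.factorial : ℝ))) ^ r⁻¹

lemma momentConst_nonneg (r : ℝ) : 0 ≤ momentConst r := by unfold momentConst; positivity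

lemma abs_rpow_le_exp_add_exp {r : ℝ} (hr : 1 ≤ r) (x : ℝ) :
    |x| ^ r ≤ (1 + (⌈r⌉₊.factorial : ℝ)) * (Real.exp x + Real.exp (-x)) := by
  have h1 : |x| ^ r ≤ 1 + |x| ^ ⌈r⌉₊ := by
    rcases le_total |x| 1 with h | h
    · have : |x| ^ r ≤ 1 := Real.rpow_le_one (abs_nonneg x) h (by linarith)
      have : 0 ≤ |x| ^ ⌈r⌉₊ := by positivity
      linarith
    · have : |x| ^ r ≤ |x| ^ ((⌈r⌉₊ : ℕ) : ℝ) := Real.rpow_le_rpow_of_exponent_le h (Nat.le_ceil r)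
      rw [Real.rpow_natCast] at this
      linarith
  have h2 := Real.pow_div_factorial_le_exp |x| (abs_nonneg x) ⌈r⌉₊
  rw [div_le_iff₀ (by positivity)] at h2
  have h3 : 1 ≤ Real.exp |x| := Real.one_le_exp (abs_nonneg x)
  have h4 : Real.exp |x| ≤ Real.exp x + Real.exp (-x) := by
    rcases abs_choice x with h | h <;> rw [h] <;> linarith [Real.exp_pos x, Real.exp_pos (-x)]
  calc _ ≤ (1 + (⌈r⌉₊.factorial : ℝ)) * Real.exp |x| := by nlinarith
    _ ≤ _ := by gcongr

lemma eLpNorm_sum_le_of_exp {r : ℝ} (hr : 1 ≤ r) {d : ℕ → Ω → ℝ} {σ : ℝ} (hσ : 0 ≤ σ)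
    (hd : ∀ i, Measurable (d i)) (hdσ : ∀ i ω, |d i ω| ≤ σ)
    (hmart : ∀ t n, ∫ ω, Real.exp (t * ∑ i ∈ Finset.range n, d i ω) * d n ω ∂P = 0) (n : ℕ) :
    eLpNorm (fun ω => ∑ i ∈ Finset.range n, d i ω) (ENNReal.ofReal r) P ≤
      ENNReal.ofReal (momentConst r * (σ * √n)) := by
  rcases Nat.eq_zero_or_pos n with rfl | hn
  · simp
  rcases hσ.eq_or_lt with rfl | hσ
  · have : ∀ i ω, d i ω = 0 := fun i ω => abs_nonpos_iff.1 (hdσ i ω)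
    simp [this]
  have hn' : 0 < √(n : ℝ) := Real.sqrt_pos.2 (by exact_mod_cast hn)
  have hr0 : 0 < r := by linarith
  have hSm : Measurable fun ω => ∑ i ∈ Finset.range n, d i ω :=
    Finset.measurable_fun_sum _ fun i _ => hd i
  have hSb : ∀ ω, |∑ i ∈ Finset.range n, d i ω| ≤ n * σ := fun ω => by
    refine (Finset.abs_sum_le_sum_abs _ _).trans ((Finset.sum_le_sum fun i _ => hdσ i ω).trans ?_)
    simp
  set t : ℝ := (σ * √n)⁻¹ with ht
  have ht0 : 0 < t := by positivity
  set x : Ω → ℝ := fun ω => t * ∑ i ∈ Finset.range n, d i ω with hx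
  have hxbm : IsBM x := IsBM.const_mul ⟨hSm, _, hSb⟩ t
  have hts : n * ((t * σ) ^ 2 / 2) = 1 / 2 := by
    have h1 : √(n : ℝ) ^ 2 = n := Real.sq_sqrt (Nat.cast_nonneg n)
    have h2 : (t * σ) ^ 2 = (n : ℝ)⁻¹ := by
      rw [ht, show (σ * √(n : ℝ))⁻¹ * σ = (√n)⁻¹ by field_simp, inv_pow, h1]
    rw [h2]
    have : (n : ℝ) ≠ 0 := by exact_mod_cast hn.ne'
    field_simp
  have hexp : Real.exp (1 / 2) ≤ 2 := by
    have h := Real.exp_one_lt_d9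
    have h2 : Real.exp (1 / 2) * Real.exp (1 / 2) = Real.exp 1 := by rw [← Real.exp_add]; norm_num
    nlinarith [Real.exp_pos (1 / 2)]
  have hE1 : ∫ ω, Real.exp (x ω) ∂P ≤ 2 := by
    have := integral_exp_mul_sum_le hσ hd hdσ t (hmart t) n
    rw [hts] at this
    exact this.trans hexp
  have hE2 : ∫ ω, Real.exp (-x ω) ∂P ≤ 2 := by
    have := integral_exp_mul_sum_le hσ hd hdσ (-t) (hmart (-t)) n
    rw [neg_mul, neg_sq, hts] at this
    simp only [neg_mul] at this
    exact this.trans hexp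
  have hexpint : ∀ y : Ω → ℝ, IsBM y → Integrable (fun ω => Real.exp (y ω)) P := by
    rintro y ⟨hy, C, hC⟩
    refine IsBM.integrable ⟨hy.exp, Real.exp C, fun ω => ?_⟩ P
    rw [Real.abs_exp, Real.exp_le_exp]
    exact (le_abs_self _).trans (hC ω)
  have hi1 := hexpint x hxbm
  have hi2 : Integrable (fun ω => Real.exp (-x ω)) P :=
    hexpint (fun ω => -x ω) (by simpa using hxbm.const_mul (-1))
  have hmom : ∫ ω, |x ω| ^ r ∂P ≤ 4 * (1 + (⌈r⌉₊.factorial : ℝ)) := by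
    calc _ ≤ ∫ ω, (1 + (⌈r⌉₊.factorial : ℝ)) * (Real.exp (x ω) + Real.exp (-x ω)) ∂P := by
          refine integral_mono_of_nonneg (ae_of_all _ fun ω => by positivity)
            ((hi1.add hi2).const_mul _) (ae_of_all _ fun ω => abs_rpow_le_exp_add_exp hr _)
      _ ≤ (1 + (⌈r⌉₊.factorial : ℝ)) * (2 + 2) := by
          rw [integral_const_mul, integral_add hi1 hi2]
          gcongr
      _ = _ := by ring
  have hmem : MemLp x (ENNReal.ofReal r) P := by
    obtain ⟨hm, C, hC⟩ := hxbm
    exact MemLp.of_bound hm.aestronglyMeasurable C (ae_of_all _ hC)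
  have hxnorm : eLpNorm x (ENNReal.ofReal r) P ≤ ENNReal.ofReal (momentConst r) := by
    rw [hmem.eLpNorm_eq_integral_rpow_norm (by simpa using hr0) ENNReal.ofReal_ne_top,
      ENNReal.toReal_ofReal hr0.le]
    refine ENNReal.ofReal_le_ofReal (Real.rpow_le_rpow ?_ hmom (by positivity))
    exact integral_nonneg fun ω => by positivity
  have hSx : (fun ω => ∑ i ∈ Finset.range n, d i ω) = (σ * √n) • x := by
    funext ω
    simp only [hx, ht, Pi.smul_apply, smul_eq_mul]
    field_simp
  rw [hSx, eLpNorm_const_smul, mul_comm (momentConst r),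
    ENNReal.ofReal_mul (by positivity), Real.enorm_of_nonneg (by positivity)]
  gcongr

end Moments

/-! ### Conditional laws -/

section CondLaw

variable {Ω H E : Type*} [MeasurableSpace Ω] [MeasurableSpace H] [MeasurableSpace E]
  {P : Measure Ω} [IsProbabilityMeasure P]

lemma map_prodMk_eq_compProd {V : Ω → H} {Y : Ω → E} (hV : Measurable V) (hY : Measurable Y)
    (κ : Kernel H E) [IsMarkovKernel κ]
    (hcond : ∀ A, MeasurableSet A →
      P⟦Y ⁻¹' A | MeasurableSpace.comap V inferInstance⟧ =ᵐ[P] fun ω => (κ (V ω)).real A) :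
    P.map (fun ω => (V ω, Y ω)) = (P.map V) ⊗ₘ κ := by
  have : IsProbabilityMeasure (P.map (fun ω => (V ω, Y ω))) :=
    Measure.isProbabilityMeasure_map (hV.prodMk hY).aemeasurable
  have : IsProbabilityMeasure (P.map V) := Measure.isProbabilityMeasure_map hV.aemeasurable
  refine Measure.ext_prod fun {s A} hs hA => ?_
  rw [Measure.compProd_apply_prod hs hA, Measure.map_apply (hV.prodMk hY) (hs.prod hA)]
  have h1 : ∫ ω in V ⁻¹' s, (P⟦Y ⁻¹' A | MeasurableSpace.comap V inferInstance⟧) ω ∂P =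
      P.real (Y ⁻¹' A ∩ V ⁻¹' s) := by
    rw [setIntegral_condExp hV.comap_le ((integrable_const 1).indicator (hY hA)) ⟨s, hs, rfl⟩]
    rw [integral_indicator (hY hA), integral_const]
    simp [Measure.real, Measure.restrict_apply (hY hA)]
  have h2 : ∫ ω in V ⁻¹' s, (P⟦Y ⁻¹' A | MeasurableSpace.comap V inferInstance⟧) ω ∂P =
      ∫ h in s, (κ h).real A ∂(P.map V) := by
    rw [setIntegral_map hs ?_ hV.aemeasurable]
    · exact integral_congr_ae (ae_restrict_of_ae (hcond A hA))
    · exact (κ.measurable_coe hA).ennreal_toReal.aestronglyMeasurable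
  have h3 : ∫ h in s, (κ h).real A ∂(P.map V) = (∫⁻ h in s, κ h A ∂(P.map V)).toReal :=
    integral_toReal (κ.measurable_coe hA).aemeasurable
      (ae_of_all _ fun h => measure_lt_top _ _)
  have h4 : ∫⁻ h in s, κ h A ∂(P.map V) ≠ ∞ := by
    refine ne_top_of_le_ne_top ENNReal.one_ne_top ?_
    calc _ ≤ ∫⁻ h in s, 1 ∂(P.map V) := lintegral_mono fun h => prob_le_one
      _ ≤ 1 := by simpa using prob_le_one
  rw [← ENNReal.toReal_eq_toReal_iff' (measure_ne_top _ _) h4, ← h3, ← h2, h1]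
  congr 2
  ext ω
  simp [and_comm]

lemma integral_mul_sub_integral_eq_zero {V : Ω → H} {Y : Ω → E} (hV : Measurable V)
    (hY : Measurable Y) (κ : Kernel H E) [IsMarkovKernel κ]
    (hcond : ∀ A, MeasurableSet A →
      P⟦Y ⁻¹' A | MeasurableSpace.comap V inferInstance⟧ =ᵐ[P] fun ω => (κ (V ω)).real A)
    {z : H → ℝ} (hz : IsBM z) {R : H × E → ℝ} (hR : IsBM R) :
    ∫ ω, z (V ω) * (R (V ω, Y ω) - ∫ y, R (V ω, y) ∂(κ (V ω))) ∂P = 0 := by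
  have : IsProbabilityMeasure (P.map V) := Measure.isProbabilityMeasure_map hV.aemeasurable
  have hint : Measurable fun h => ∫ y, R (h, y) ∂(κ h) :=
    (StronglyMeasurable.integral_kernel_prod_right' hR.1.stronglyMeasurable).measurable
  set g : H × E → ℝ := fun p => z p.1 * (R p - ∫ y, R (p.1, y) ∂(κ p.1)) with hg
  have hgm : Measurable g := (hz.1.comp measurable_fst).mul
    (hR.1.sub (hint.comp measurable_fst))
  have hgb : IsBM g := by
    obtain ⟨C, hC⟩ := hz.2
    obtain ⟨D, hD⟩ := hR.2
    refine ⟨hgm, C * (D + D), fun p => ?_⟩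
    rw [hg, abs_mul]
    refine mul_le_mul (hC _) ((abs_sub _ _).trans (add_le_add (hD _) ?_)) (abs_nonneg _)
      ((abs_nonneg _).trans (hC p.1))
    simpa using norm_integral_le_of_norm_le_const (μ := κ p.1) (f := fun y => R (p.1, y)) (C := D)
      (ae_of_all _ fun y => hD _)
  have hslice : ∀ h, Integrable (fun y => R (h, y)) (κ h) := by
    intro h
    obtain ⟨D, hD⟩ := hR.2
    exact IsBM.integrable ⟨hR.1.comp measurable_prodMk_left, D, fun y => hD _⟩ _
  calc _ = ∫ p, g p ∂(P.map (fun ω => (V ω, Y ω))) :=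
        (integral_map (hV.prodMk hY).aemeasurable hgm.aestronglyMeasurable).symm
    _ = 0 := by
        rw [map_prodMk_eq_compProd hV hY κ hcond, Measure.integral_compProd (hgb.integrable _)]
        refine integral_eq_zero_of_ae (ae_of_all _ fun h => ?_)
        simp only [hg, Pi.zero_apply]
        rw [integral_const_mul, integral_sub (hslice h) (integrable_const _)]
        simp

end CondLaw

/-! ### Measurability in a parameter -/

section Parameter

variable {T E : Type*} [MeasurableSpace T] [MeasurableSpace E] {K : T → Kernel E E}
  [∀ t, IsMarkovKernel (K t)]

lemma measurable_act_param (hK : Measurable fun p : T × E => K p.1 p.2) {h : T → E → ℝ}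
    (hh : Measurable fun p : T × E => h p.1 p.2) :
    Measurable fun p : T × E => act (K p.1) (h p.1) p.2 := by
  let κ : Kernel (T × E) E := ⟨fun p => K p.1 p.2, hK⟩
  have : IsMarkovKernel κ := ⟨fun p => inferInstanceAs (IsProbabilityMeasure (K p.1 p.2))⟩
  have h1 : Measurable fun q : (T × E) × E => h q.1.1 q.2 :=
    hh.comp ((measurable_fst.comp measurable_fst).prodMk measurable_snd)
  exact (StronglyMeasurable.integral_kernel_prod_right' (κ := κ) h1.stronglyMeasurable).measurable

lemma measurable_act_pow_param (hK : Measurable fun p : T × E => K p.1 p.2) {f : E → ℝ}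
    (hf : IsBM f) (n : ℕ) : Measurable fun p : T × E => act (K p.1 ^ n) f p.2 := by
  induction n with
  | zero =>
    simp only [act_pow_zero hf]
    exact hf.1.comp measurable_snd
  | succ n ih =>
    simp only [act_pow_succ hf]
    exact measurable_act_param hK (h := fun t => act (K t ^ n) f) ih

lemma measurable_poisson_param (hK : Measurable fun p : T × E => K p.1 p.2) {f : E → ℝ}
    (hf : IsBM f) {N : ℕ} {b : ℝ} (hb : ∀ t, dobrushin (K t ^ N) ≤ b) (hb1 : b < 1) (x₀ : E) :
    Measurable fun p : T × E => poisson (K p.1) N x₀ f p.2 := by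
  have hlim : Tendsto (fun (m : ℕ) (p : T × E) => ∑ i ∈ Finset.range (m * N),
      (act (K p.1 ^ i) f p.2 - act (K p.1 ^ i) f x₀)) atTop
      (𝓝 fun p : T × E => poisson (K p.1) N x₀ f p.2) := by
    rw [tendsto_pi_nhds]
    intro p
    exact tendsto_poisson (hb p.1) hb1 hf x₀ p.2
  refine measurable_of_tendsto_metrizable (fun m => ?_) hlim
  refine Finset.measurable_fun_sum _ fun i _ => ?_
  have h := measurable_act_pow_param hK hf i
  have h' : Measurable fun p : T × E => act (K p.1 ^ i) f x₀ :=
    h.comp (g := fun p : T × E => act (K p.1 ^ i) f p.2) (f := fun p : T × E => (p.1, x₀))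
      (measurable_fst.prodMk measurable_const)
  exact h.sub h'

end Parameter

/-! ### Inhomogeneous chains driven by an auxiliary process -/

section DrivenChain

variable {G E : Type*} [MeasurableSpace G] [MeasurableSpace E]

lemma sum_telescope (ρ : ℕ → ℕ → ℝ) (n : ℕ) :
    ∑ p ∈ Finset.range (n + 1), (ρ p p - ρ p (p + 1)) =
      ρ 0 0 - ρ n (n + 1) + ∑ p ∈ Finset.range n, (ρ (p + 1) (p + 1) - ρ p (p + 1)) := by
  induction n with
  | zero => simp
  | succ n ih => rw [Finset.sum_range_succ, ih, Finset.sum_range_succ _ n]; ring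

lemma sum_inv_sqrt_le (n : ℕ) :
    ∑ p ∈ Finset.range n, (√((p : ℝ) + 1))⁻¹ ≤ 2 * √(n : ℝ) := by
  induction n with
  | zero => simp
  | succ n ih =>
    rw [Finset.sum_range_succ]
    push_cast
    have h1 : √((n : ℝ) + 1) ^ 2 = n + 1 := Real.sq_sqrt (by positivity)
    have h2 : √(n : ℝ) ^ 2 = n := Real.sq_sqrt (by positivity)
    have h3 : 0 < √((n : ℝ) + 1) := by positivity
    have h4 : (√((n : ℝ) + 1))⁻¹ ≤ 2 * (√((n : ℝ) + 1) - √(n : ℝ)) := by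
      rw [inv_le_iff_one_le_mul₀ h3]
      nlinarith [sq_nonneg (√((n : ℝ) + 1) - √(n : ℝ))]
    linarith

lemma sum_inv_le (n : ℕ) :
    ∑ p ∈ Finset.range n, ((p : ℝ) + 2)⁻¹ ≤ 2 * √((n : ℝ) + 1) := by
  have h : ∀ p : ℕ, ((p : ℝ) + 2)⁻¹ ≤ (√((p : ℝ) + 1))⁻¹ := fun p => by
    refine inv_anti₀ (by positivity) ((Real.sqrt_le_iff).2 ⟨by positivity, ?_⟩)
    nlinarith [(Nat.cast_nonneg p : (0 : ℝ) ≤ p)]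
  refine (Finset.sum_le_sum fun p _ => h p).trans ((sum_inv_sqrt_le n).trans ?_)
  gcongr
  linarith

lemma div_one_sub_le_sq (N : ℕ) {b : ℝ} (hb0 : 0 ≤ b) (hb1 : b < 1) :
    (N : ℝ) / (1 - b) ≤ ((N : ℝ) / (1 - b)) ^ 2 := by
  rcases Nat.eq_zero_or_pos N with rfl | hN
  · simp
  · have hN' : (1 : ℝ) ≤ N := by exact_mod_cast hN
    have h1 : 1 ≤ (N : ℝ) / (1 - b) := by
      rw [le_div_iff₀ (by linarith)]; linarith
    nlinarith

/-- The martingale increment attached to the Poisson equation at time `n`. -/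
noncomputable def increment (K : ∀ n, (Fin (n + 1) → G) → Kernel E E) (N : ℕ) (x₀ : E) (f : E → ℝ)
    (n : ℕ) (z : Fin (n + 1) → G) (x y : E) : ℝ :=
  poisson (K n z) N x₀ f y - act (K n z) (poisson (K n z) N x₀ f) x

variable {K : ∀ n, (Fin (n + 1) → G) → Kernel E E} [∀ n z, IsMarkovKernel (K n z)]
  {N : ℕ} {b : ℝ} {f : E → ℝ} {x₀ : E}

lemma measurable_poisson_comp (hK : ∀ n, Measurable fun p : (Fin (n + 1) → G) × E => K n p.1 p.2)
    (hb : ∀ n z, dobrushin (K n z ^ N) ≤ b) (hb1 : b < 1) (hf : IsBM f) (n : ℕ)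
    {T : Type*} [MeasurableSpace T] {z : T → Fin (n + 1) → G} {y : T → E}
    (hz : Measurable z) (hy : Measurable y) :
    Measurable fun t => poisson (K n (z t)) N x₀ f (y t) := by
  have h1 := measurable_poisson_param (hK n) hf (hb n) hb1 x₀
  exact h1.comp (g := fun p : (Fin (n + 1) → G) × E => poisson (K n p.1) N x₀ f p.2)
    (hz.prodMk hy)

lemma measurable_increment (hK : ∀ n, Measurable fun p : (Fin (n + 1) → G) × E => K n p.1 p.2)
    (hb : ∀ n z, dobrushin (K n z ^ N) ≤ b) (hb1 : b < 1) (hf : IsBM f) (n : ℕ)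
    {T : Type*} [MeasurableSpace T] {z : T → Fin (n + 1) → G} {x y : T → E}
    (hz : Measurable z) (hx : Measurable x) (hy : Measurable y) :
    Measurable fun t => increment K N x₀ f n (z t) (x t) (y t) := by
  have h1 := measurable_poisson_param (hK n) hf (hb n) hb1 x₀
  have h2 := measurable_act_param (hK n) (h := fun z => poisson (K n z) N x₀ f) h1
  have h3 : Measurable fun t => act (K n (z t)) (poisson (K n (z t)) N x₀ f) (x t) :=
    h2.comp (g := fun p : (Fin (n + 1) → G) × E =>
      act (K n p.1) (poisson (K n p.1) N x₀ f) p.2) (hz.prodMk hx)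
  exact (measurable_poisson_comp hK hb hb1 hf n hz hy).sub h3

omit [MeasurableSpace G] in
lemma abs_increment_le (hb : ∀ n z, dobrushin (K n z ^ N) ≤ b) (hb1 : b < 1) (hf : IsBM f)
    {a : ℝ} (ha : ∀ x y, |f x - f y| ≤ a) {π : ∀ n, (Fin (n + 1) → G) → Measure E}
    [∀ n z, IsProbabilityMeasure (π n z)] (hπ : ∀ n z, (K n z).Invariant (π n z))
    (n : ℕ) (z : Fin (n + 1) → G) (x y : E) :
    |increment K N x₀ f n z x y| ≤ N / (1 - b) * a := by
  have hP := hf.poisson_sol (hb n z) hb1 x₀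
  refine abs_integral_sub_le hP (K n z x) fun w => ?_
  refine abs_sub_le_of_poisson (c := -∫ y, f y ∂(π n z)) (hb n z) hb1 hP hf (fun v => ?_) ha y w
  rw [poisson_sub_act (hb n z) hb1 hf x₀ (hπ n z), sub_eq_add_neg]

variable {Ω : Type*} [MeasurableSpace Ω] {P : Measure Ω} [IsProbabilityMeasure P]
  {Z : ℕ → Ω → G} {Y : ℕ → Ω → E}

lemma integral_exp_mul_increment_eq_zero (hZ : ∀ n, Measurable (Z n)) (hY : ∀ n, Measurable (Y n))
    (hK : ∀ n, Measurable fun p : (Fin (n + 1) → G) × E => K n p.1 p.2)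
    (hb : ∀ n z, dobrushin (K n z ^ N) ≤ b) (hb1 : b < 1) (hf : IsBM f)
    {π : ∀ n, (Fin (n + 1) → G) → Measure E}
    [∀ n z, IsProbabilityMeasure (π n z)] (hπ : ∀ n z, (K n z).Invariant (π n z))
    (hcond : ∀ n A, MeasurableSet A →
      P⟦Y (n + 1) ⁻¹' A | pathSigma Z ⊔ pastSigma Y n⟧ =ᵐ[P]
        fun ω => (K n (fun i => Z i ω) (Y n ω)).real A) (t : ℝ) (n : ℕ) :
    ∫ ω, Real.exp (t * ∑ i ∈ Finset.range n,
        increment K N x₀ f i (fun j => Z j ω) (Y i ω) (Y (i + 1) ω)) *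
      increment K N x₀ f n (fun j => Z j ω) (Y n ω) (Y (n + 1) ω) ∂P = 0 := by
  let V : Ω → (ℕ → G) × (Fin (n + 1) → E) := fun ω => (fun i => Z i ω, fun i => Y i ω)
  have hV : Measurable V := (measurable_pi_lambda _ fun i => hZ i).prodMk
    (measurable_pi_lambda _ fun i => hY i)
  have hκm : Measurable fun h : (ℕ → G) × (Fin (n + 1) → E) =>
      ((fun i : Fin (n + 1) => h.1 i, h.2 (Fin.last n)) : (Fin (n + 1) → G) × E) := by fun_prop
  let κ : Kernel ((ℕ → G) × (Fin (n + 1) → E)) E :=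
    ⟨fun h => K n (fun i => h.1 i) (h.2 (Fin.last n)), (hK n).comp hκm⟩
  have : IsMarkovKernel κ :=
    ⟨fun h => inferInstanceAs (IsProbabilityMeasure (K n (fun i => h.1 i) (h.2 (Fin.last n))))⟩
  let z : (ℕ → G) × (Fin (n + 1) → E) → ℝ := fun h => Real.exp (t * ∑ i : Fin n,
    increment K N x₀ f i (fun j => h.1 j) (h.2 i.castSucc) (h.2 i.succ))
  have hz : IsBM z := by
    have hs : IsBM fun h : (ℕ → G) × (Fin (n + 1) → E) => t * ∑ i : Fin n,
        increment K N x₀ f i (fun j => h.1 j) (h.2 i.castSucc) (h.2 i.succ) := by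
      refine IsBM.const_mul (IsBM.sum fun i _ => ⟨?_, N / (1 - b) * osc f, fun h =>
        abs_increment_le hb hb1 hf (abs_sub_le_osc hf) hπ _ _ _ _⟩) t
      exact measurable_increment hK hb hb1 hf i (by fun_prop) (by fun_prop) (by fun_prop)
    obtain ⟨hm, C, hC⟩ := hs
    refine ⟨hm.exp, Real.exp C, fun h => ?_⟩
    rw [Real.abs_exp, Real.exp_le_exp]
    exact (le_abs_self _).trans (hC h)
  let R : ((ℕ → G) × (Fin (n + 1) → E)) × E → ℝ := fun p =>
    poisson (K n (fun i => p.1.1 i)) N x₀ f p.2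
  have hR : IsBM R := by
    refine ⟨?_, N / (1 - b) * osc f, fun p => abs_poisson_le (hb _ _) hb1 hf (abs_sub_le_osc hf) _ _⟩
    exact measurable_poisson_comp hK hb hb1 hf n (by fun_prop) measurable_snd
  have hσ : MeasurableSpace.comap V inferInstance = pathSigma Z ⊔ pastSigma Y n :=
    MeasurableSpace.comap_prodMk _ _
  have key := integral_mul_sub_integral_eq_zero (P := P) (V := V) hV (hY (n + 1)) κ
    (fun A hA => by rw [hσ]; exact hcond n A hA) hz hR
  refine (integral_congr_ae (ae_of_all _ fun ω => ?_)).trans key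
  simp only [z, V, R, κ, increment]
  rw [Finset.sum_range]
  rfl

/-- The `L^r` bound for the fluctuations of a chain driven by an auxiliary process. -/
lemma exists_eLpNorm_le_of_driven_chain {r : ℝ} (hr : 1 ≤ r)
    (hZ : ∀ n, Measurable (Z n)) (hY : ∀ n, Measurable (Y n))
    (hK : ∀ n, Measurable fun p : (Fin (n + 1) → G) × E => K n p.1 p.2)
    (hb : ∀ n z, dobrushin (K n z ^ N) ≤ b) (hb1 : b < 1) (hf : IsBM f) (hf1 : ∀ x, |f x| ≤ 1)
    {π : ∀ n, (Fin (n + 1) → G) → Measure E}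
    [∀ n z, IsProbabilityMeasure (π n z)] (hπ : ∀ n z, (K n z).Invariant (π n z))
    {c : ℝ} (hc : 0 ≤ c)
    (hlip : ∀ n (z : ℕ → G) x, tvDist (K (n + 1) (fun i => z i) x) (K n (fun i => z i) x) ≤
      c * (2 * ((n : ℝ) + 2)⁻¹))
    (hcond : ∀ n A, MeasurableSet A →
      P⟦Y (n + 1) ⁻¹' A | pathSigma Z ⊔ pastSigma Y n⟧ =ᵐ[P]
        fun ω => (K n (fun i => Z i ω) (Y n ω)).real A) (n : ℕ) :
    ∃ W : Ω → ℝ, Measurable W ∧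
      (∀ ω, |∑ p ∈ Finset.range (n + 1), (f (Y p ω) - ∫ x, f x ∂(π p fun i => Z i ω))| ≤ W ω) ∧
      eLpNorm W (ENNReal.ofReal r) P ≤ ENNReal.ofReal (√((n : ℝ) + 1) *
        ((2 * momentConst r + 20) * ((1 + c) * ((N : ℝ) / (1 - b)) ^ 2))) := by
  obtain ⟨ω₀⟩ : Nonempty Ω := P.nonempty_of_neZero
  let x₀ : E := Y 0 ω₀
  have hb0 : 0 ≤ b := (dobrushin_nonneg _).trans (hb 0 fun i => Z i ω₀)
  set A : ℝ := (N : ℝ) / (1 - b) with hA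
  have hA0 : 0 ≤ A := div_nonneg (Nat.cast_nonneg _) (by linarith)
  have ha : ∀ x y, |f x - f y| ≤ 2 := fun x y => by
    have := abs_sub (f x) (f y)
    linarith [hf1 x, hf1 y]
  let d : ℕ → Ω → ℝ := fun i ω => increment K N x₀ f i (fun j => Z j ω) (Y i ω) (Y (i + 1) ω)
  have hd : ∀ i, Measurable (d i) := fun i =>
    measurable_increment hK hb hb1 hf i (measurable_pi_lambda _ fun j => hZ j) (hY i) (hY (i + 1))
  have hdσ : ∀ i ω, |d i ω| ≤ A * 2 := fun i ω =>
    abs_increment_le hb hb1 hf ha hπ i _ _ _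
  have hS : Measurable fun ω => ∑ i ∈ Finset.range (n + 1), d i ω :=
    Finset.measurable_fun_sum _ fun i _ => hd i
  have hmart := eLpNorm_sum_le_of_exp (P := P) hr (by positivity) hd hdσ
    (fun t m => integral_exp_mul_increment_eq_zero hZ hY hK hb hb1 hf hπ hcond t m) (n + 1)
  set s : ℝ := √((n : ℝ) + 1) with hs
  have hs1 : 1 ≤ s := Real.one_le_sqrt.2 (by linarith [(Nat.cast_nonneg n : (0 : ℝ) ≤ n)])
  set D : ℝ := 4 * A + 16 * A ^ 2 * c * s with hD
  have hD0 : 0 ≤ D := by positivity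
  refine ⟨fun ω => |∑ i ∈ Finset.range (n + 1), d i ω| + D,
    hS.abs.add measurable_const, fun ω => ?_, ?_⟩
  · let ρ : ℕ → ℕ → ℝ := fun p q => poisson (K p fun j => Z j ω) N x₀ f (Y q ω)
    have hpt : ∀ p, f (Y p ω) - ∫ x, f x ∂(π p fun i => Z i ω) =
        d p ω + (ρ p p - ρ p (p + 1)) := fun p => by
      rw [← poisson_sub_act (hb p _) hb1 hf x₀ (hπ p _)]
      simp only [d, ρ, increment]
      ring
    have hρ : ∀ p q, |ρ p q| ≤ A * 2 := fun p q => abs_poisson_le (hb p _) hb1 hf ha x₀ _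
    have hρ' : ∀ p, |ρ (p + 1) (p + 1) - ρ p (p + 1)| ≤ 8 * A ^ 2 * c * ((p : ℝ) + 2)⁻¹ := by
      intro p
      refine (abs_poisson_sub_poisson_le (hb _ _) (hb _ _) hb1 hf ha x₀ (hπ _ _) (hπ _ _)
        (hlip p fun j => Z j ω) (Y (p + 1) ω)).trans (le_of_eq ?_)
      ring
    have hsum : |∑ p ∈ Finset.range n, (ρ (p + 1) (p + 1) - ρ p (p + 1))| ≤
        16 * A ^ 2 * c * s := by
      refine (Finset.abs_sum_le_sum_abs _ _).trans ((Finset.sum_le_sum fun p _ => hρ' p).trans ?_)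
      rw [← Finset.mul_sum]
      calc _ ≤ 8 * A ^ 2 * c * (2 * s) := by gcongr; exact sum_inv_le n
        _ = _ := by ring
    simp only [hpt]
    rw [Finset.sum_add_distrib, sum_telescope]
    refine (abs_add_le _ _).trans (add_le_add le_rfl ?_)
    refine (abs_add_le _ _).trans ?_
    have := abs_sub (ρ 0 0) (ρ n (n + 1))
    linarith [hρ 0 0, hρ n (n + 1)]
  · have hp1 : (1 : ℝ≥0∞) ≤ ENNReal.ofReal r := by simpa using ENNReal.ofReal_le_ofReal hr
    have hadd := eLpNorm_add_le (μ := P) hS.abs.aestronglyMeasurable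
      (aestronglyMeasurable_const (b := D)) hp1
    refine hadd.trans ?_
    have habs : eLpNorm (fun ω => |∑ i ∈ Finset.range (n + 1), d i ω|) (ENNReal.ofReal r) P =
        eLpNorm (fun ω => ∑ i ∈ Finset.range (n + 1), d i ω) (ENNReal.ofReal r) P :=
      eLpNorm_norm fun ω => ∑ i ∈ Finset.range (n + 1), d i ω
    have hDn : eLpNorm (fun _ : Ω => D) (ENNReal.ofReal r) P = ENNReal.ofReal D := by
      rw [eLpNorm_const _ (by simp; linarith) (NeZero.ne P), measure_univ, ENNReal.one_rpow,
        mul_one, Real.enorm_of_nonneg hD0]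
    rw [habs, hDn]
    refine (add_le_add hmart le_rfl).trans ?_
    have hC := momentConst_nonneg r
    rw [← ENNReal.ofReal_add (by positivity) hD0]
    refine ENNReal.ofReal_le_ofReal ?_
    push_cast
    rw [← hs]
    have hAA : A ≤ A ^ 2 := div_one_sub_le_sq N hb0 hb1
    have h1 : momentConst r * (A * 2 * s) ≤ s * (2 * momentConst r * A ^ 2) := by
      have : s * (2 * momentConst r * A) ≤ s * (2 * momentConst r * A ^ 2) := by gcongr
      linarith
    have h2 : 4 * A ≤ s * (4 * A ^ 2) := by nlinarith [sq_nonneg A]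
    have h3 : 0 ≤ s * (momentConst r * c * A ^ 2) := by positivity
    have h4 : 0 ≤ s * (c * A ^ 2) := by positivity
    have h5 : 0 ≤ s * A ^ 2 := by positivity
    rw [hD]
    linarith

end DrivenChain

/-! ### Occupation measures -/

section Occupation

variable {Ω E : Type*} [MeasurableSpace E]

lemma integral_empirical {f : E → ℝ} (hf : Measurable f) {n : ℕ} (x : Fin (n + 1) → E) :
    ∫ y, f y ∂(empirical x : Measure E) = ((n : ℝ) + 1)⁻¹ * ∑ p, f (x p) := by
  have : (empirical x : Measure E) =
      ((n + 1 : ℕ) : ℝ≥0∞)⁻¹ • ∑ p : Fin (n + 1), Measure.dirac (x p) := rfl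
  rw [this, integral_smul_measure, integral_finsetSum_measure fun p _ =>
    integrable_dirac' hf.stronglyMeasurable (by simp)]
  simp only [integral_dirac' _ _ hf.stronglyMeasurable, smul_eq_mul]
  rw [ENNReal.toReal_inv, ENNReal.toReal_natCast, Nat.cast_succ]

lemma integral_occ {f : E → ℝ} (hf : Measurable f) (X : ℕ → Ω → E) (n : ℕ) (ω : Ω) :
    ∫ y, f y ∂(occ X n ω : Measure E) =
      ((n : ℝ) + 1)⁻¹ * ∑ p ∈ Finset.range (n + 1), f (X p ω) := by
  rw [occ, integral_empirical hf, Finset.sum_range]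

lemma tvDist_empirical_succ_le (z : ℕ → E) (n : ℕ) :
    tvDist (empirical fun i : Fin (n + 2) => z i : Measure E)
      (empirical fun i : Fin (n + 1) => z i : Measure E) ≤ 2 * ((n : ℝ) + 2)⁻¹ := by
  refine tvDist_le (by positivity) fun f hf h1 => ?_
  rw [integral_empirical hf.1, integral_empirical hf.1,
    ← Finset.sum_range fun i => f (z i), ← Finset.sum_range fun i => f (z i),
    Finset.sum_range_succ _ (n + 1)]
  have hS : |∑ i ∈ Finset.range (n + 1), f (z i)| ≤ n + 1 := by
    refine (Finset.abs_sum_le_sum_abs _ _).trans ((Finset.sum_le_sum fun i _ => h1 _).trans ?_)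
    simp
  have hlast := h1 (z (n + 1))
  set S := ∑ i ∈ Finset.range (n + 1), f (z i)
  have h2 : (((n + 1 : ℕ) : ℝ) + 1)⁻¹ * (S + f (z (n + 1))) - ((n : ℝ) + 1)⁻¹ * S =
      ((n : ℝ) + 2)⁻¹ * (f (z (n + 1)) - ((n : ℝ) + 1)⁻¹ * S) := by
    push_cast
    field_simp
    ring
  have h3 : |((n : ℝ) + 1)⁻¹ * S| ≤ 1 := by
    rw [abs_mul, abs_of_pos (by positivity), inv_mul_le_iff₀ (by positivity), mul_one]
    exact hS
  rw [h2, abs_mul, abs_of_pos (by positivity), mul_comm]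
  refine mul_le_mul_of_nonneg_right ?_ (by positivity)
  have := abs_sub (f (z (n + 1))) (((n : ℝ) + 1)⁻¹ * S)
  linarith

end Occupation

/-! ### A Minkowski inequality for the weak Lipschitz condition -/

section Minkowski

/-- A form of Minkowski's integral inequality. -/
lemma eLpNorm_lintegral_le {Ω B : Type*} [MeasurableSpace Ω] [MeasurableSpace B] {P : Measure Ω}
    [SFinite P] {Γ : Measure B} [SFinite Γ] {r : ℝ} (hr : 1 ≤ r) {h : Ω → B → ℝ≥0∞}
    (hh : AEMeasurable (Function.uncurry h) (P.prod Γ)) {w : B → ℝ≥0∞} (hw : AEMeasurable w Γ)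
    (hwtop : ∀ g, w g ≠ ∞) (hw0 : ∀ g, w g = 0 → ∀ ω, h ω g = 0) {C : ℝ≥0∞}
    (hC : ∀ g, eLpNorm (fun ω => h ω g) (ENNReal.ofReal r) P ≤ C * w g) :
    eLpNorm (fun ω => ∫⁻ g, h ω g ∂Γ) (ENNReal.ofReal r) P ≤ C * ∫⁻ g, w g ∂Γ := by
  have hr0 : 0 < r := by linarith
  have hp0 : ENNReal.ofReal r ≠ 0 := by simpa using hr0
  have hnorm : ∀ F : Ω → ℝ≥0∞, eLpNorm F (ENNReal.ofReal r) P = (∫⁻ ω, F ω ^ r ∂P) ^ (1 / r) := by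
    intro F
    rw [eLpNorm_eq_lintegral_rpow_enorm_toReal hp0 ENNReal.ofReal_ne_top,
      ENNReal.toReal_ofReal hr0.le]
    simp
  set γ : Measure B := Γ.withDensity w with hγ
  have hac : γ ≪ Γ := withDensity_absolutelyContinuous _ _
  set u : Ω → B → ℝ≥0∞ := fun ω g => h ω g / w g with hu
  have hum : AEMeasurable (Function.uncurry u) (P.prod Γ) :=
    hh.div (hw.comp_quasiMeasurePreserving Measure.quasiMeasurePreserving_snd)
  have humγ : AEMeasurable (Function.uncurry u) (P.prod γ) :=
    hum.mono_ac (Measure.AbsolutelyContinuous.rfl.prod hac)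
  have huw : ∀ ω g, w g * u ω g = h ω g := fun ω g => by
    rcases eq_or_ne (w g) 0 with h0 | h0
    · rw [h0, zero_mul, hw0 g h0]
    · exact ENNReal.mul_div_cancel h0 (hwtop g)
  have hslice : ∀ᵐ ω ∂P, AEMeasurable (u ω) Γ :=
    hum.aestronglyMeasurable.prodMk_left.mono fun ω h => h.aemeasurable
  have hγuniv : γ Set.univ = ∫⁻ g, w g ∂Γ := by
    rw [hγ, withDensity_apply _ MeasurableSet.univ, Measure.restrict_univ]
  have hjensen : ∀ᵐ ω ∂P, (∫⁻ g, h ω g ∂Γ) ^ r ≤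
      (∫⁻ g, u ω g ^ r ∂γ) * (γ Set.univ) ^ (r - 1) := by
    filter_upwards [hslice] with ω hω
    have h1 : ∫⁻ g, h ω g ∂Γ = ∫⁻ g, u ω g ∂γ := by
      rw [hγ, lintegral_withDensity_eq_lintegral_mul₀ hw hω]
      exact lintegral_congr fun g => (huw ω g).symm
    have h2 := eLpNorm_le_eLpNorm_mul_rpow_measure_univ (μ := γ) (p := 1) (q := ENNReal.ofReal r)
      (by simpa using ENNReal.ofReal_le_ofReal hr) (hω.mono_ac hac).aestronglyMeasurable
    rw [eLpNorm_one_eq_lintegral_enorm, eLpNorm_eq_lintegral_rpow_enorm_toReal hp0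
      ENNReal.ofReal_ne_top, ENNReal.toReal_ofReal hr0.le] at h2
    simp only [enorm_eq_self, ENNReal.toReal_one] at h2
    rw [h1]
    refine (ENNReal.rpow_le_rpow h2 hr0.le).trans (le_of_eq ?_)
    rw [ENNReal.mul_rpow_of_nonneg _ _ hr0.le, ← ENNReal.rpow_mul, ← ENNReal.rpow_mul,
      one_div_mul_cancel hr0.ne', ENNReal.rpow_one]
    congr 2
    field_simp
  have hinner : ∀ g, w g ≠ 0 → ∫⁻ ω, u ω g ^ r ∂P ≤ C ^ r := by
    intro g h0
    have h1 := hC g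
    rw [hnorm, one_div, ENNReal.rpow_inv_le_iff hr0, ENNReal.mul_rpow_of_nonneg _ _ hr0.le] at h1
    have hwr0 : w g ^ r ≠ 0 := by simp [ENNReal.rpow_eq_zero_iff, h0, hwtop g]
    have hwrt : w g ^ r ≠ ∞ := ENNReal.rpow_ne_top_of_nonneg hr0.le (hwtop g)
    have h2 : ∫⁻ ω, u ω g ^ r ∂P = (∫⁻ ω, h ω g ^ r ∂P) / w g ^ r := by
      have h3 : ∀ ω, u ω g ^ r = h ω g ^ r / w g ^ r := fun ω =>
        ENNReal.div_rpow_of_nonneg _ _ hr0.le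
      simp only [h3]
      simp only [div_eq_mul_inv]
      exact lintegral_mul_const' _ _ (ENNReal.inv_ne_top.2 hwr0)
    rw [h2]
    exact ENNReal.div_le_of_le_mul h1
  rw [hnorm, one_div, ENNReal.rpow_inv_le_iff hr0]
  calc ∫⁻ ω, (∫⁻ g, h ω g ∂Γ) ^ r ∂P
      ≤ ∫⁻ ω, (∫⁻ g, u ω g ^ r ∂γ) * (γ Set.univ) ^ (r - 1) ∂P := lintegral_mono_ae hjensen
    _ = (∫⁻ ω, ∫⁻ g, u ω g ^ r ∂γ ∂P) * (γ Set.univ) ^ (r - 1) :=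
        lintegral_mul_const'' _ (humγ.pow_const r).lintegral_prod_right'
    _ = (∫⁻ g, ∫⁻ ω, u ω g ^ r ∂P ∂γ) * (γ Set.univ) ^ (r - 1) := by
        rw [lintegral_lintegral_swap (humγ.pow_const r)]
    _ ≤ (C ^ r * γ Set.univ) * (γ Set.univ) ^ (r - 1) := by
        gcongr
        rw [← lintegral_const]
        refine lintegral_mono_ae ?_
        have : ∀ᵐ g ∂γ, w g ≠ 0 := by
          rw [hγ, ae_withDensity_iff_ae_restrict' hw]
          exact ae_restrict_mem₀ (hw.nullMeasurableSet_preimage (measurableSet_singleton 0).compl)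
        filter_upwards [this] with g hg using hinner g hg
    _ = (C * ∫⁻ g, w g ∂Γ) ^ r := by
        rw [← hγuniv, ENNReal.mul_rpow_of_nonneg _ _ hr0.le, mul_assoc]
        congr 1
        have := ENNReal.rpow_add_of_nonneg (x := γ Set.univ) 1 (r - 1) zero_le_one (by linarith)
        rwa [add_sub_cancel, ENNReal.rpow_one, eq_comm] at this

end Minkowski

/-! ### Propagation of the error through the mappings -/

section Propagation

variable {Ω : Type*} [MeasurableSpace Ω] {P : Measure Ω} [IsProbabilityMeasure P]

lemma measurable_integral_occ {E : Type*} [MeasurableSpace E] {f : E → ℝ} (hf : Measurable f)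
    {X : ℕ → Ω → E} (hX : ∀ n, Measurable (X n)) (n : ℕ) :
    Measurable fun ω => ∫ y, f y ∂(occ X n ω : Measure E) := by
  simp only [integral_occ hf]
  exact (Finset.measurable_fun_sum _ fun i _ => hf.comp (hX i)).const_mul _

lemma WeakLipschitz.exists_eLpNorm_le {E F : Type u} [MeasurableSpace E] [MeasurableSpace F]
    {Φ : ProbabilityMeasure E → ProbabilityMeasure F} {Λ : ℝ≥0} (hΦ : WeakLipschitz Φ Λ)
    {r : ℝ} (hr : 1 ≤ r) {X : ℕ → Ω → E} (hX : ∀ n, Measurable (X n)) (π : ProbabilityMeasure E)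
    (f : BM F) (n : ℕ) {C : ℝ≥0∞}
    (hC : ∀ g : BM E, eLpNorm (fun ω => ∫ x, g x ∂(occ X n ω : Measure E) -
      ∫ x, g x ∂(π : Measure E)) (ENNReal.ofReal r) P ≤ C * ENNReal.ofReal (supNorm g)) :
    ∃ W : Ω → ℝ≥0∞, AEMeasurable W P ∧
      (∀ ω, ‖∫ y, f y ∂(Φ (occ X n ω) : Measure F) - ∫ y, f y ∂(Φ π : Measure F)‖ₑ ≤ W ω) ∧
      eLpNorm W (ENNReal.ofReal r) P ≤ C * (Λ * ENNReal.ofReal (supNorm f)) := by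
  obtain ⟨mB, Γ, hΓ⟩ := hΦ
  obtain ⟨hfin, hev, hsup, hlip, hΛ⟩ := hΓ f
  have hterm : ∀ p, AEMeasurable (fun q : Ω × BM E => q.2.1 (X p q.1)) (P.prod (Γ f)) := by
    intro p
    have hprob : IsProbabilityMeasure (P.map (X p)) :=
      Measure.isProbabilityMeasure_map (hX p).aemeasurable
    have hq : Measure.QuasiMeasurePreserving (Prod.map (X p) (id : BM E → BM E))
        (P.prod (Γ f)) ((P.map (X p)).prod (Γ f)) :=
      MeasureTheory.QuasiMeasurePreserving.prodMap
        ((hX p).measurePreserving P).quasiMeasurePreserving (Measure.QuasiMeasurePreserving.id _)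
    exact (hev ⟨P.map (X p), hprob⟩).comp_quasiMeasurePreserving hq
  have hπ : AEMeasurable (fun g : BM E => ∫ x, g x ∂(π : Measure E)) (Γ f) :=
    ((hev π).aestronglyMeasurable.prod_swap.integral_prod_right').aemeasurable
  have hjoint : AEMeasurable (Function.uncurry fun (ω : Ω) (g : BM E) =>
      ‖∫ x, g x ∂(occ X n ω : Measure E) - ∫ x, g x ∂(π : Measure E)‖ₑ) (P.prod (Γ f)) := by
    have hsum : AEMeasurable (fun q : Ω × BM E =>
        ((n : ℝ) + 1)⁻¹ * ∑ p ∈ Finset.range (n + 1), q.2.1 (X p q.1)) (P.prod (Γ f)) :=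
      (Finset.aemeasurable_fun_sum _ fun p _ => hterm p).const_mul _
    have heq : (Function.uncurry fun (ω : Ω) (g : BM E) =>
        ‖∫ x, g x ∂(occ X n ω : Measure E) - ∫ x, g x ∂(π : Measure E)‖ₑ) =
        fun q : Ω × BM E => ‖((n : ℝ) + 1)⁻¹ * ∑ p ∈ Finset.range (n + 1), q.2.1 (X p q.1) -
          ∫ x, q.2 x ∂(π : Measure E)‖ₑ := by
      funext q
      simp only [Function.uncurry, integral_occ q.2.2.1]
    rw [heq]
    exact (hsum.sub (hπ.comp_quasiMeasurePreserving
      Measure.quasiMeasurePreserving_snd)).enorm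
  refine ⟨fun ω => ∫⁻ g, ‖∫ x, g.1 x ∂(occ X n ω : Measure E) - ∫ x, g.1 x ∂(π : Measure E)‖ₑ
    ∂(Γ f), hjoint.lintegral_prod_right', fun ω => ?_, ?_⟩
  · simpa only [Real.enorm_eq_ofReal_abs] using hlip (occ X n ω) π
  · refine (eLpNorm_lintegral_le hr hjoint hsup.ennreal_ofReal (fun _ => ENNReal.ofReal_ne_top)
      (fun g hg ω => ?_) fun g => (eLpNorm_enorm _).le.trans (hC g)).trans
      (mul_le_mul_right hΛ C)
    have h0 : ∀ x, g.1 x = 0 := fun x =>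
      abs_nonpos_iff.1 ((abs_le_supNorm g.2 x).trans (ENNReal.ofReal_eq_zero.1 hg))
    simp [h0]

end Propagation

/-! ### The levels of the algorithm -/

section Levels

variable {S : ℕ → Type u} [∀ l, MeasurableSpace (S l)] {m : Model S} {Ω : Type v}
  [MeasurableSpace Ω] {P : Measure Ω} [IsProbabilityMeasure P] {X : ∀ k, ℕ → Ω → S k}

instance (m : Model S) : IsMarkovKernel m.M0 := m.M0_markov

instance (m : Model S) (l : ℕ) (μ : ProbabilityMeasure (S l)) : IsMarkovKernel (m.M l μ) :=
  m.M_markov l μ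

lemma Model.dobrushin_le_b (m : Model S) (l N : ℕ) (μ : ProbabilityMeasure (S l)) :
    dobrushin (m.M l μ ^ N) ≤ m.b (l + 1) N :=
  le_ciSup (f := fun μ => dobrushin (m.M l μ ^ N))
    ⟨1, by rintro _ ⟨μ, rfl⟩; exact dobrushin_le_one _⟩ μ

/-- The fluctuation bound of a single level. -/
noncomputable def levelConst (m : Model S) (r : ℝ) (c : ℕ → ℝ≥0) (N : ℕ → ℕ) (l : ℕ) : ℝ :=
  (2 * momentConst r + 20) * ((1 + (c l : ℝ)) * ((N l : ℝ) / (1 - m.b l (N l))) ^ 2)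

lemma levelConst_nonneg (m : Model S) (r : ℝ) (c : ℕ → ℝ≥0) (N : ℕ → ℕ) (l : ℕ) :
    0 ≤ levelConst m r c N l := by
  have := momentConst_nonneg r
  unfold levelConst
  positivity

lemma IsChain.exists_eLpNorm_le_zero (hX : IsChain m P X) {r : ℝ} (hr : 1 ≤ r) (c : ℕ → ℝ≥0)
    (N : ℕ → ℕ) (hb : m.b 0 (N 0) < 1) {f : S 0 → ℝ} (hf : IsBM f) (hf1 : ∀ x, |f x| ≤ 1)
    (n : ℕ) :
    ∃ W : Ω → ℝ, Measurable W ∧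
      (∀ ω, |∑ p ∈ Finset.range (n + 1), (f (X 0 p ω) - ∫ x, f x ∂(m.π 0 : Measure (S 0)))|
        ≤ W ω) ∧
      eLpNorm W (ENNReal.ofReal r) P ≤
        ENNReal.ofReal (√((n : ℝ) + 1) * levelConst m r c N 0) := by
  refine exists_eLpNorm_le_of_driven_chain (G := Unit) (Z := fun _ _ => ())
    (K := fun _ _ => m.M0) (π := fun _ _ => (m.π 0 : Measure (S 0))) hr
    (fun _ => measurable_const) (hX.measurable 0) (fun _ => m.M0.measurable.comp measurable_snd)
    (fun _ _ => le_rfl) hb hf hf1 (fun _ _ => m.M0_invariant) (c 0).coe_nonneg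
    (fun n z x => ?_) (fun n A hA => ?_) n
  · refine tvDist_le (by positivity) fun g _ _ => ?_
    rw [sub_self, abs_zero]
    positivity
  · have : pathSigma (fun (_ : ℕ) (_ : Ω) => ()) = ⊥ := MeasurableSpace.comap_const _
    rw [this, bot_sup_eq]
    exact hX.step_zero n A hA

lemma IsChain.exists_eLpNorm_le_succ (hX : IsChain m P X) {r : ℝ} (hr : 1 ≤ r) (c : ℕ → ℝ≥0)
    (N : ℕ → ℕ) (k : ℕ)
    (hlip : ∀ μ ν : ProbabilityMeasure (S k), kernelDist (m.M k μ) (m.M k ν) ≤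
      c (k + 1) * tvDist (μ : Measure (S k)) (ν : Measure (S k)))
    (hb : m.b (k + 1) (N (k + 1)) < 1) {f : S (k + 1) → ℝ} (hf : IsBM f)
    (hf1 : ∀ x, |f x| ≤ 1) (n : ℕ) :
    ∃ W : Ω → ℝ, Measurable W ∧
      (∀ ω, |∑ p ∈ Finset.range (n + 1), (f (X (k + 1) p ω) -
        ∫ x, f x ∂(m.Φ k (occ (X k) p ω) : Measure (S (k + 1))))| ≤ W ω) ∧
      eLpNorm W (ENNReal.ofReal r) P ≤
        ENNReal.ofReal (√((n : ℝ) + 1) * levelConst m r c N (k + 1)) := by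
  refine exists_eLpNorm_le_of_driven_chain (Z := X k)
    (K := fun _ z => m.M k (empirical z))
    (π := fun _ z => (m.Φ k (empirical z) : Measure (S (k + 1)))) hr
    (hX.measurable k) (hX.measurable (k + 1)) (fun n => m.M_measurable k n)
    (fun _ _ => m.dobrushin_le_b k _ _) hb hf hf1 (fun _ _ => m.M_invariant k _)
    (c (k + 1)).coe_nonneg (fun n z x => ?_) (fun n A hA => hX.step_succ k n A hA) n
  refine (tvDist_le_kernelDist _ _ x).trans ((hlip _ _).trans ?_)
  exact mul_le_mul_of_nonneg_left (tvDist_empirical_succ_le z n) (c (k + 1)).coe_nonneg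

/-- The bound on the error of level `k`. -/
noncomputable def errorConst (m : Model S) (r : ℝ) (Λ c : ℕ → ℝ≥0) (N : ℕ → ℕ) (k : ℕ) : ℝ :=
  ∑ l ∈ Finset.range (k + 1), levelConst m r c N l * ∏ i ∈ Finset.Ioc l k, 2 * (Λ i : ℝ)

lemma errorConst_nonneg (m : Model S) (r : ℝ) (Λ c : ℕ → ℝ≥0) (N : ℕ → ℕ) (k : ℕ) :
    0 ≤ errorConst m r Λ c N k :=
  Finset.sum_nonneg fun l _ => mul_nonneg (levelConst_nonneg m r c N l)
    (Finset.prod_nonneg fun i _ => by positivity)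

lemma errorConst_succ (m : Model S) (r : ℝ) (Λ c : ℕ → ℝ≥0) (N : ℕ → ℕ) (k : ℕ) :
    errorConst m r Λ c N (k + 1) =
      levelConst m r c N (k + 1) + 2 * Λ (k + 1) * errorConst m r Λ c N k := by
  unfold errorConst
  rw [Finset.sum_range_succ, Finset.Ioc_self, Finset.prod_empty, mul_one, add_comm,
    Finset.mul_sum]
  congr 1
  refine Finset.sum_congr rfl fun l hl => ?_
  have hl' : l ≤ k := Nat.lt_succ_iff.1 (Finset.mem_range.1 hl)
  rw [Finset.prod_Ioc_succ_top hl']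
  ring

omit [IsProbabilityMeasure P] in
lemma eLpNorm_le_of_eLpNorm_mul_le {D : Ω → ℝ} {p : ℝ≥0∞} (n : ℕ) {a : ℝ}
    (h : eLpNorm (fun ω => ((n : ℝ) + 1) * D ω) p P ≤ ENNReal.ofReal (√((n : ℝ) + 1) * a)) :
    eLpNorm D p P ≤ ENNReal.ofReal ((√((n : ℝ) + 1))⁻¹ * a) := by
  have hcancel : ((n : ℝ) + 1)⁻¹ * (√((n : ℝ) + 1) * a) = (√((n : ℝ) + 1))⁻¹ * a := by
    have hs : 0 < √((n : ℝ) + 1) := by positivity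
    have hss : √((n : ℝ) + 1) * √((n : ℝ) + 1) = n + 1 := Real.mul_self_sqrt (by positivity)
    generalize √((n : ℝ) + 1) = s at *
    rw [← hss]
    field_simp
  have hD : D = ((n : ℝ) + 1)⁻¹ • fun ω => ((n : ℝ) + 1) * D ω := by
    funext ω
    simp only [Pi.smul_apply, smul_eq_mul]
    field_simp
  rw [hD, eLpNorm_const_smul, Real.enorm_of_nonneg (by positivity)]
  refine (mul_le_mul_right h _).trans (le_of_eq ?_)
  rw [← ENNReal.ofReal_mul (by positivity), hcancel]

omit [MeasurableSpace Ω] in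
lemma mul_integral_occ_sub {E : Type*} [MeasurableSpace E] {f : E → ℝ} (hf : Measurable f)
    (Y : ℕ → Ω → E) (n : ℕ) (ω : Ω) (y : ℝ) :
    ((n : ℝ) + 1) * (∫ x, f x ∂(occ Y n ω : Measure E) - y) =
      ∑ p ∈ Finset.range (n + 1), (f (Y p ω) - y) := by
  rw [integral_occ hf, Finset.sum_sub_distrib]
  simp only [Finset.sum_const, Finset.card_range, nsmul_eq_mul]
  push_cast
  field_simp

omit [IsProbabilityMeasure P] in
/-- Homogeneity in the test function. -/
lemma eLpNorm_integral_sub_le_of_supNorm_le_one {E : Type u} [MeasurableSpace E]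
    {μ : Ω → Measure E} {π : Measure E} {p C : ℝ≥0∞}
    (h : ∀ g : BM E, supNorm g ≤ 1 →
      eLpNorm (fun ω => ∫ x, g x ∂(μ ω) - ∫ x, g x ∂π) p P ≤ C) (g : BM E) :
    eLpNorm (fun ω => ∫ x, g x ∂(μ ω) - ∫ x, g x ∂π) p P ≤ C * ENNReal.ofReal (supNorm g) := by
  rcases (supNorm_nonneg g.1).eq_or_lt with h0 | h0
  · have hz : ∀ x, g.1 x = 0 := fun x =>
      abs_nonpos_iff.1 ((abs_le_supNorm g.2 x).trans h0.ge)
    simp [hz]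
  · have hn : supNorm (fun x => (supNorm g.1)⁻¹ * g.1 x) ≤ 1 := by
      refine Real.iSup_le (fun x => ?_) zero_le_one
      rw [abs_mul, abs_of_pos (inv_pos.2 h0), inv_mul_le_iff₀ h0, mul_one]
      exact abs_le_supNorm g.2 x
    have h1 := h ⟨fun x => (supNorm g.1)⁻¹ * g.1 x, IsBM.const_mul g.2 _⟩ hn
    have h2 : (fun ω => ∫ x, g x ∂(μ ω) - ∫ x, g x ∂π) = supNorm g.1 • fun ω =>
        ∫ x, (supNorm g.1)⁻¹ * g.1 x ∂(μ ω) - ∫ x, (supNorm g.1)⁻¹ * g.1 x ∂π := by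
      funext ω
      simp only [Pi.smul_apply, smul_eq_mul, integral_const_mul]
      field_simp
    rw [h2, eLpNorm_const_smul, Real.enorm_of_nonneg h0.le, mul_comm]
    gcongr

lemma IsChain.eLpNorm_occ_sub_le (hX : IsChain m P X) {r : ℝ} (hr : 1 ≤ r) {Λ c : ℕ → ℝ≥0}
    {N : ℕ → ℕ} (hΦ : ∀ l, WeakLipschitz (m.Φ l) (Λ (l + 1)))
    (hlip : ∀ l (μ ν : ProbabilityMeasure (S l)), kernelDist (m.M l μ) (m.M l ν) ≤
      c (l + 1) * tvDist (μ : Measure (S l)) (ν : Measure (S l)))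
    (hb : ∀ l, m.b l (N l) < 1) (k : ℕ) (f : BM (S k)) (hf : supNorm f ≤ 1) (n : ℕ) :
    eLpNorm (fun ω => ∫ x, f x ∂(occ (X k) n ω : Measure (S k)) -
        ∫ x, f x ∂(m.π k : Measure (S k))) (ENNReal.ofReal r) P ≤
      ENNReal.ofReal ((√((n : ℝ) + 1))⁻¹ * errorConst m r Λ c N k) := by
  have hp1 : (1 : ℝ≥0∞) ≤ ENNReal.ofReal r := by simpa using ENNReal.ofReal_le_ofReal hr
  induction k generalizing n with
  | zero =>
    obtain ⟨W, hW, hle, hnorm⟩ := hX.exists_eLpNorm_le_zero hr c N (hb 0) f.2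
      (fun x => (abs_le_supNorm f.2 x).trans hf) n
    refine eLpNorm_le_of_eLpNorm_mul_le n ?_
    have h0 : errorConst m r Λ c N 0 = levelConst m r c N 0 := by simp [errorConst]
    rw [h0]
    simp only [mul_integral_occ_sub f.2.1]
    exact (eLpNorm_mono_real hle).trans hnorm
  | succ k ih =>
    have hf1 : ∀ x, |f.1 x| ≤ 1 := fun x => (abs_le_supNorm f.2 x).trans hf
    obtain ⟨W, hW, hle, hnorm⟩ := hX.exists_eLpNorm_le_succ hr c N k (hlip k) (hb (k + 1)) f.2
      hf1 n
    have hstep := fun p : ℕ => (hΦ k).exists_eLpNorm_le (P := P) hr (hX.measurable k) (m.π k) f p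
      (eLpNorm_integral_sub_le_of_supNorm_le_one fun g hg => ih g hg p)
    choose F hF hFle hFnorm using hstep
    refine eLpNorm_le_of_eLpNorm_mul_le n ?_
    have hpt : ∀ ω, ‖((n : ℝ) + 1) * (∫ x, f x ∂(occ (X (k + 1)) n ω : Measure (S (k + 1))) -
        ∫ x, f x ∂(m.π (k + 1) : Measure (S (k + 1))))‖ₑ ≤
        ‖‖W ω‖ₑ + (∑ p ∈ Finset.range (n + 1), F p) ω‖ₑ := by
      intro ω
      rw [mul_integral_occ_sub f.2.1, m.π_succ, enorm_eq_self, Finset.sum_apply]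
      have hsplit : ∑ p ∈ Finset.range (n + 1), (f.1 (X (k + 1) p ω) -
          ∫ x, f.1 x ∂(m.Φ k (m.π k) : Measure (S (k + 1)))) =
          ∑ p ∈ Finset.range (n + 1), (f.1 (X (k + 1) p ω) -
            ∫ x, f.1 x ∂(m.Φ k (occ (X k) p ω) : Measure (S (k + 1)))) +
          ∑ p ∈ Finset.range (n + 1), (∫ x, f.1 x ∂(m.Φ k (occ (X k) p ω) : Measure (S (k + 1))) -
            ∫ x, f.1 x ∂(m.Φ k (m.π k) : Measure (S (k + 1)))) := by
        rw [← Finset.sum_add_distrib]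
        exact Finset.sum_congr rfl fun p _ => by ring
      rw [hsplit]
      refine (enorm_add_le _ _).trans (add_le_add ?_ ?_)
      · simp only [Real.enorm_eq_ofReal_abs]
        exact ENNReal.ofReal_le_ofReal ((hle ω).trans (le_abs_self _))
      · exact (enorm_sum_le _ _).trans (Finset.sum_le_sum fun p _ => hFle p ω)
    refine (eLpNorm_mono_enorm hpt).trans ((eLpNorm_add_le hW.enorm.aestronglyMeasurable
      (Finset.aemeasurable_sum _ fun p _ => hF p).aestronglyMeasurable hp1).trans ?_)
    have ha := errorConst_nonneg m r Λ c N k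
    have hsum : eLpNorm (∑ p ∈ Finset.range (n + 1), F p) (ENNReal.ofReal r) P ≤
        ENNReal.ofReal (√((n : ℝ) + 1) * (2 * Λ (k + 1) * errorConst m r Λ c N k)) := by
      refine (eLpNorm_sum_le (fun p _ => (hF p).aestronglyMeasurable) hp1).trans ?_
      have hterm : ∀ p, eLpNorm (F p) (ENNReal.ofReal r) P ≤
          ENNReal.ofReal (Λ (k + 1) * errorConst m r Λ c N k * (√((p : ℝ) + 1))⁻¹) := by
        intro p
        have h1 : ENNReal.ofReal (supNorm f) ≤ 1 := by
          simpa using ENNReal.ofReal_le_ofReal hf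
        refine (hFnorm p).trans ((mul_le_mul_right (mul_le_mul_right h1 _) _).trans
          (le_of_eq ?_))
        rw [mul_one, ← ENNReal.ofReal_coe_nnreal, ← ENNReal.ofReal_mul (by positivity)]
        congr 1
        ring
      refine (Finset.sum_le_sum fun p _ => hterm p).trans ?_
      rw [← ENNReal.ofReal_sum_of_nonneg fun p _ => by positivity, ← Finset.mul_sum]
      refine ENNReal.ofReal_le_ofReal ?_
      have h2 := sum_inv_sqrt_le (n + 1)
      push_cast at h2
      calc _ ≤ Λ (k + 1) * errorConst m r Λ c N k * (2 * √((n : ℝ) + 1)) := by gcongr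
        _ = _ := by ring
    refine (add_le_add ((eLpNorm_enorm _).le.trans hnorm) hsum).trans (le_of_eq ?_)
    have hl := levelConst_nonneg m r c N (k + 1)
    rw [← ENNReal.ofReal_add (by positivity) (by positivity), errorConst_succ, mul_add]

end Levels

end IMCMC

theorem mainTheorem3 (r : ℝ) (hr : 1 ≤ r) :
    ∃ e : ℝ, ∀ (S : ℕ → Type u) [∀ l, MeasurableSpace (S l)] (m : IMCMC.Model S)
      (Λ c : ℕ → ℝ≥0) (N : ℕ → ℕ),
      (∀ l, IMCMC.WeakLipschitz (m.Φ l) (Λ (l + 1))) →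
      (∀ l (μ ν : ProbabilityMeasure (S l)),
        IMCMC.kernelDist (m.M l μ) (m.M l ν) ≤
          c (l + 1) * IMCMC.tvDist (μ : Measure (S l)) (ν : Measure (S l))) →
      (∀ l, m.b l (N l) < 1) →
      ∀ (Ω : Type v) [MeasurableSpace Ω] (P : Measure Ω) [IsProbabilityMeasure P]
        (X : ∀ k, ℕ → Ω → S k), IMCMC.IsChain m P X →
      ∀ (k : ℕ) (f : IMCMC.BM (S k)), IMCMC.supNorm f ≤ 1 → ∀ n : ℕ,
        Real.sqrt (n + 1) *
          (∫ ω, |∫ x, f x ∂(IMCMC.occ (X k) n ω : Measure (S k)) -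
              ∫ x, f x ∂(m.π k : Measure (S k))| ^ r ∂P) ^ (1 / r) ≤
        e * ∑ l ∈ Finset.range (k + 1),
          (1 + (c l : ℝ)) * ((N l : ℝ) / (1 - m.b l (N l))) ^ 2 *
            ∏ i ∈ Finset.Ioc l k, 2 * (Λ i : ℝ) := by
  refine ⟨2 * IMCMC.momentConst r + 20, ?_⟩
  intro S _ m Λ c N hΦ hlip hb Ω _ P _ X hX k f hf n
  have hr0 : 0 < r := by linarith
  have hmain := hX.eLpNorm_occ_sub_le hr hΦ hlip hb k f hf n
  have hmem : MemLp (fun ω => ∫ x, f x ∂(IMCMC.occ (X k) n ω : Measure (S k)) -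
      ∫ x, f x ∂(m.π k : Measure (S k))) (ENNReal.ofReal r) P :=
    ⟨((IMCMC.measurable_integral_occ f.2.1 (hX.measurable k) n).sub_const _).aestronglyMeasurable,
      hmain.trans_lt ENNReal.ofReal_lt_top⟩
  have ha := IMCMC.errorConst_nonneg m r Λ c N k
  rw [hmem.eLpNorm_eq_integral_rpow_norm (by simpa using hr0) ENNReal.ofReal_ne_top,
    ENNReal.toReal_ofReal hr0.le, ENNReal.ofReal_le_ofReal_iff (by positivity)] at hmain
  simp only [Real.norm_eq_abs] at hmain
  rw [one_div, ← le_inv_mul_iff₀ (by positivity)]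
  refine hmain.trans (le_of_eq ?_)
  congr 1
  rw [IMCMC.errorConst, Finset.mul_sum]
  refine Finset.sum_congr rfl fun l _ => ?_
  rw [IMCMC.levelConst]
  ring
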